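/- Let $k \ge 2$ be an integer. For a positive definite symmetric real $k\times k$ matrix $Z$ let $E(Z,s)$ denote the Epstein zeta-function, defined for $\Re s>1$ by the absolutely convergent series $$E(Z,s)=\sum_{\mathbf{x}\in\mathbb{Z}^k\setminus\{0\}}(\mathbf{x}^{\top}Z\mathbf{x})^{-ks/2}$$ and extended to $\mathbb{C}\setminus\{1\}$ by analytic continuation. Let $D$ be a compact set of diagonal matrices $\mathrm{diag}(\xi_1,\dots,\xi_k)$ with positive diagonal entries, regarded as a compact subset of $(0,\infty)^k$. Then for every $Z\in D$ this analytic continuation exists, and there is a set $M\subseteq D$ of full measure (that is, $D\setminus M$ has $k$-dimensional Lebesgue measure $0$) such that for every $Z\in M$ and every $\varepsilon>0$ $$\int_0^X|E(Z,1/2+it)|^2\,dt\ll_{Z,\varepsilon}X^{1+\varepsilon}\qquad\text{for all } X\ge 1,$$ and in particular $$E(Z,1/2+it)\ll_{Z,\varepsilon}(1+|t|)^{1/2+\varepsilon}\qquad\text{for all } t\in\mathbb{R}.$$ -/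

import Mathlib

open Set Filter Topology MeasureTheory

/-- The quadratic form `Q(x) = xᵀ Z x`, evaluated at an integral vector. -/
def quadFormAt {k : ℕ} (Z : Matrix (Fin k) (Fin k) ℝ) (x : Fin k → ℤ) : ℝ :=
  (fun i => (x i : ℝ)) ⬝ᵥ Z.mulVec (fun i => (x i : ℝ))

/-- `F` is the analytic continuation to `ℂ ∖ {1}` of the Epstein zeta-function of `Z`:
it is holomorphic away from `1`, and for `Re s > 1` it is the (unconditionally convergent) sum of
`Q(x) ^ (-k s / 2)` over the non-zero integral vectors `x`. The value `F 1` is irrelevant. -/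
def IsEpsteinContinuation {k : ℕ} (Z : Matrix (Fin k) (Fin k) ℝ) (F : ℂ → ℂ) : Prop :=
  DifferentiableOn ℂ F {1}ᶜ ∧
    ∀ s : ℂ, 1 < s.re →
      HasSum (fun x : {x : Fin k → ℤ // x ≠ 0} =>
        (quadFormAt Z x.1 : ℂ) ^ (-((k : ℂ) * s / 2))) (F s)

/-- The continuation is unique away from the pole `s = 1`. -/
theorem IsEpsteinContinuation.eqOn {k : ℕ} {Z : Matrix (Fin k) (Fin k) ℝ} {F G : ℂ → ℂ}
    (hF : IsEpsteinContinuation Z F) (hG : IsEpsteinContinuation Z G) :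
    EqOn F G {1}ᶜ := by
  have ho : IsOpen ({1}ᶜ : Set ℂ) := isOpen_compl_singleton
  have hc : IsPreconnected ({1}ᶜ : Set ℂ) :=
    (isConnected_compl_singleton_of_one_lt_rank (by simp) (1 : ℂ)).isPreconnected
  have h2 : (2 : ℂ) ∈ ({1}ᶜ : Set ℂ) := by simp
  refine (hF.1.analyticOnNhd ho).eqOn_of_preconnected_of_eventuallyEq
    (hG.1.analyticOnNhd ho) hc h2 ?_
  have hU : IsOpen {s : ℂ | 1 < s.re} := isOpen_lt continuous_const Complex.continuous_re
  filter_upwards [hU.mem_nhds (show (2 : ℂ) ∈ {s : ℂ | 1 < s.re} by simp)] with s hs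
  exact (hF.2 s hs).unique (hG.2 s hs)

/-- The Epstein zeta-function `E(Z, s)`, as a function of `s` on `ℂ ∖ {1}`: the analytic
continuation of its Dirichlet series (arbitrary if there is no such continuation). -/
noncomputable def epsteinZeta {k : ℕ} (Z : Matrix (Fin k) (Fin k) ℝ) : ℂ → ℂ :=
  Classical.epsilon (IsEpsteinContinuation Z)

/-! Put `w = k s / 2`, let `Q` be the form and `Θ(z) = ∑ exp (-π Q(n) z)`. For every `ω` with `Re ω
> 0`, the Mellin transform of `Θ - 1` along the ray through `ω` is `(π ω) ^ (-w) Γ(w) E`. Splitting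
at `x = 1` and using the functional equation of `Θ` continues `E`, and by uniqueness the
continuation does not depend on `ω` (`epsteinZeta_eq_thetaContinuation`). For `t` of size `T = 2 ^
j`, take `|ω| = 1` and `arg ω = π / 2 - 1 / T`. Then `|ω ^ w|` offsets the exponential decay of
`Γ(w)`, and `E(1/2 + it)` is `T ^ (1/2 - k/4)` times two Mellin integrals of theta tails over `(1,
∞)`, up to pole terms (`exists_norm_epsteinZeta_le_dyadic`). Plancherel bounds the mean square of
these integrals by a weighted mean `thetaMean` of `|Θ - 1|²` on the ray, and Cauchy-Schwarz bounds
them pointwise by the same mean. Everything reduces to `thetaMean ≪ T ^ (k/2 + ε)`, for the form and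
for its dual. This holds for almost every diagonal form. Expand `|Θ - 1|²` and integrate over the `ξ
i`: the pair `(n, m)` oscillates with frequencies proportional to `n_i² - m_i²` and is damped by `∏
1 / (1 + |n_i² - m_i²|)`. This kernel has bounded row sums, so only the diagonal matters, and it
contributes about `(Re ω) ^ (-k/2)`, that is `T ^ (k/2)` (`exists_integral_norm_sum_sq_le`). A
Borel-Cantelli argument over `j` passes from the average to almost every `ξ` (`ae_thetaMean_le`). -/

/-! ### Product series over integral vectors. -/

theorem hasSum_pi_prod_succ {R : Type*} [RCLike R] {ι : Type*} {k : ℕ}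
    (f : Fin (k + 1) → ι → R) (hf : Summable fun n => ‖f 0 n‖)
    (ih : (Summable fun n : Fin k → ι => ‖∏ i, f i.succ (n i)‖) ∧
        HasSum (fun n : Fin k → ι => ∏ i, f i.succ (n i)) (∏ i, ∑' n, f (Fin.succ i) n)) :
      (Summable fun n : Fin (k + 1) → ι => ‖∏ i, f i (n i)‖) ∧
        HasSum (fun n : Fin (k + 1) → ι => ∏ i, f i (n i)) (∏ i, ∑' n, f i n) := by
  obtain ⟨h1, h2⟩ := ih
  have h4 : Summable fun p : ι × (Fin k → ι) => ‖f 0 p.1 * ∏ i, f i.succ (p.2 i)‖ := by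
    have h := Summable.mul_of_nonneg hf h1 (fun _ => norm_nonneg _) (fun _ => norm_nonneg _)
    exact h.congr fun p => (norm_mul _ _).symm
  have key : (fun p : ι × (Fin k → ι) => f 0 p.1 * ∏ i, f i.succ (p.2 i)) =
        (fun n : Fin (k + 1) → ι => ∏ i, f i (n i)) ∘ (Fin.consEquiv (fun _ => ι)) := by
    ext p
    simp [Fin.prod_univ_succ, Fin.consEquiv]
  constructor
  · rw [← (Fin.consEquiv (fun _ => ι)).summable_iff]
    refine h4.congr fun p => ?_
    exact congrArg norm (congrFun key p)
  · rw [← (Fin.consEquiv (fun _ => ι)).hasSum_iff, ← key, Fin.prod_univ_succ]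
    have h5 := HasSum.mul hf.of_norm.hasSum h2 h4.of_norm
    exact h5

/-- Products of absolutely convergent series, indexed by integral vectors. -/
theorem summable_norm_and_hasSum_pi_prod {R : Type*} [RCLike R] {ι : Type*} {k : ℕ} (f : Fin k → ι → R)
    (hf : ∀ i, Summable fun n => ‖f i n‖) :
      (Summable fun n : Fin k → ι => ‖∏ i, f i (n i)‖) ∧
        HasSum (fun n : Fin k → ι => ∏ i, f i (n i)) (∏ i, ∑' n, f i n) := by
  induction k with
  | zero =>
    refine ⟨(hasSum_unique (fun n : Fin 0 → ι => ‖∏ i, f i (n i)‖)).summable, ?_⟩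
    have := hasSum_unique (fun n : Fin 0 → ι => ∏ i, f i (n i))
    rwa [Finset.univ_eq_empty, Finset.prod_empty] at this ⊢
  | succ k ih =>
    exact hasSum_pi_prod_succ f (hf 0) (ih (fun i => f i.succ) (fun i => hf i.succ))

/-- The series of `(1 + max |n_i|) ^ (-r)` over integral vectors. -/
theorem summable_one_add_norm_rpow {k : ℕ} {r : ℝ} (hr : (k : ℝ) < r) :
    Summable fun n : Fin k → ℤ => (1 + ‖n‖) ^ (-r) := by
  rcases Nat.eq_zero_or_pos k with rfl | hk
  · exact Summable.of_finite
  have hk' : (0 : ℝ) < k := by exact_mod_cast hk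
  have hr0 : 0 < r := hk'.trans hr
  have h1 : Summable fun n : ℤ => ‖(1 + ‖n‖) ^ (-(r / k))‖ := by
    have : Summable fun n : ℤ => |(n : ℝ)| ^ (-(r / k)) :=
      Real.summable_abs_int_rpow (by rwa [lt_div_iff₀ hk', one_mul])
    refine Summable.of_norm_bounded_eventually (g := fun n : ℤ => |(n : ℝ)| ^ (-(r / k))) this ?_
    have : ({0} : Set ℤ)ᶜ ∈ cofinite := (finite_singleton 0).compl_mem_cofinite
    filter_upwards [this] with n hn
    have hn' : 0 < |(n : ℝ)| := by simpa using hn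
    rw [norm_norm, Real.norm_of_nonneg (by positivity), Int.norm_eq_abs]
    exact Real.rpow_le_rpow_of_nonpos hn' (by linarith) (by simp; positivity)
  -- The sup norm dominates each coordinate, so the term is at most a product of one-variable terms
  -- with exponent `r / k > 1`.
  have h2 := (summable_norm_and_hasSum_pi_prod (k := k)
    (fun _ (n : ℤ) => (1 + ‖n‖) ^ (-(r / k))) (fun _ => h1)).1
  refine h2.of_nonneg_of_le (fun n => by positivity) fun n => ?_
  rw [Real.norm_of_nonneg (Finset.prod_nonneg fun i _ => by positivity)]
  calc (1 + ‖n‖) ^ (-r) = ∏ i : Fin k, (1 + ‖n‖) ^ (-(r / k)) := by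
        rw [Finset.prod_const, Finset.card_univ, Fintype.card_fin, ← Real.rpow_natCast,
          ← Real.rpow_mul (by positivity)]
        congr 1; field_simp
    _ ≤ _ := by
        refine Finset.prod_le_prod (fun i _ => by positivity) fun i _ => ?_
        refine Real.rpow_le_rpow_of_nonpos (by positivity) ?_ (by simp; positivity)
        linarith [norm_le_pi_norm n i]

section

open Complex

/-! ### Euler's integral with complex parameter. -/

/-- Euler's integral, with a complex scaling factor. -/
theorem integral_cpow_mul_exp_neg_mul_Ioi_of_re_pos {a r : ℂ} (ha : 0 < a.re) (hr : 0 < r.re) :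
    ∫ t : ℝ in Ioi 0, (t : ℂ) ^ (a - 1) * exp (-(r * t)) = r ^ (-a) * Gamma a := by
  have hint : ∀ c : ℝ, 0 < c → ∀ b : ℝ, 0 < b →
      IntegrableOn (fun t : ℝ => t ^ (b - 1) * Real.exp (-(c * t))) (Ioi 0) := by
    intro c hc b hb
    have := integrableOn_rpow_mul_exp_neg_mul_rpow (p := 1) (s := b - 1) (by linarith) one_pos hc
    simpa using this
  have hmeas : ∀ (b z : ℂ), AEStronglyMeasurable
      (fun t : ℝ => (t : ℂ) ^ (b - 1) * exp (-(z * t))) (volume.restrict (Ioi 0)) := by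
    intro b z
    refine ContinuousOn.aestronglyMeasurable ?_ measurableSet_Ioi
    refine ContinuousOn.mul ?_ (by fun_prop)
    exact continuousOn_of_forall_continuousAt fun t ht =>
      continuousAt_ofReal_cpow_const _ _ (Or.inr (ne_of_gt ht))
  have hnorm : ∀ (b z : ℂ) (t : ℝ), 0 < t → ‖(t : ℂ) ^ (b - 1) * exp (-(z * t))‖ =
      t ^ (b.re - 1) * Real.exp (-(z.re * t)) := by
    intro b z t ht
    rw [norm_mul, norm_cpow_eq_rpow_re_of_pos ht, norm_exp]
    simp
  have hopen : IsOpen {z : ℂ | 0 < z.re} := isOpen_lt continuous_const continuous_re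
  have hd : DifferentiableOn ℂ (fun z : ℂ => ∫ t : ℝ in Ioi 0, (t : ℂ) ^ (a - 1) * exp (-(z * t)))
      {z | 0 < z.re} := by
    intro z hz
    have hz : 0 < z.re := hz
    refine DifferentiableAt.differentiableWithinAt ?_
    have hs : {w : ℂ | z.re / 2 < w.re} ∈ 𝓝 z :=
      (isOpen_lt continuous_const continuous_re).mem_nhds (by simp [hz])
    have := hasDerivAt_integral_of_dominated_loc_of_deriv_le
      (μ := volume.restrict (Ioi (0 : ℝ)))
      (F := fun (z : ℂ) (t : ℝ) => (t : ℂ) ^ (a - 1) * exp (-(z * t)))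
      (F' := fun (z : ℂ) (t : ℝ) => -((t : ℂ) ^ (a + 1 - 1) * exp (-(z * t))))
      (bound := fun t : ℝ => t ^ ((a + 1).re - 1) * Real.exp (-(z.re / 2 * t))) hs
      (Eventually.of_forall fun w => hmeas a w) ?_ (hmeas (a + 1) z).neg ?_
      (hint _ (by linarith) _ (by simp; linarith)) ?_
    · exact this.2.differentiableAt
    · refine (integrable_norm_iff (hmeas a z)).1 ?_
      refine (hint z.re hz a.re ha).congr_fun (fun t ht => (hnorm a z t ht).symm)
        measurableSet_Ioi
    · refine (ae_restrict_iff' measurableSet_Ioi).2 (ae_of_all _ fun t ht w hw => ?_)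
      have ht : 0 < t := ht
      have hw : z.re / 2 < w.re := hw
      rw [norm_neg, hnorm _ _ _ ht]
      gcongr
    · refine (ae_restrict_iff' measurableSet_Ioi).2 (ae_of_all _ fun t ht w _ => ?_)
      have ht' : (t : ℂ) ≠ 0 := by exact_mod_cast (ne_of_gt ht)
      have h1 : HasDerivAt (fun w : ℂ => -(w * t)) (-(t : ℂ)) w := by
        simpa using! ((hasDerivAt_id w).mul_const (t : ℂ)).neg
      convert! h1.cexp.const_mul ((t : ℂ) ^ (a - 1)) using 1
      rw [show a + 1 - 1 = (a - 1) + 1 by ring, cpow_add _ _ ht', cpow_one]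
      ring
  have hd2 : DifferentiableOn ℂ (fun z : ℂ => z ^ (-a) * Gamma a) {z | 0 < z.re} := by
    intro z hz
    refine DifferentiableAt.differentiableWithinAt ?_
    refine DifferentiableAt.mul_const ?_ _
    exact differentiableAt_id.cpow_const (Or.inl hz)
  have hconv : IsPreconnected {z : ℂ | 0 < z.re} := (convex_halfSpace_re_gt 0).isPreconnected
  -- Both sides are holomorphic in the scaling factor on the right half-plane, and they agree at the
  -- real points `1 + 1 / (n + 1)`, which accumulate at `1`.
  refine (hd.analyticOnNhd hopen).eqOn_of_preconnected_of_frequently_eq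
    (hd2.analyticOnNhd hopen) hconv (z₀ := 1) (by simp) ?_ hr
  have hreal : ∀ x : ℝ, 0 < x → (∫ t : ℝ in Ioi 0, (t : ℂ) ^ (a - 1) * exp (-((x : ℂ) * t))) =
      (x : ℂ) ^ (-a) * Gamma a := by
    intro x hx
    rw [integral_cpow_mul_exp_neg_mul_Ioi ha hx, one_div, inv_cpow _ _ (by
      rw [arg_ofReal_of_nonneg hx.le]; exact Real.pi_pos.ne), cpow_neg]
  have hlim : Tendsto (fun n : ℕ => ((1 + 1 / ((n : ℝ) + 1) : ℝ) : ℂ)) atTop (𝓝[≠] 1) := by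
    refine tendsto_nhdsWithin_iff.2 ⟨?_, Eventually.of_forall fun n => ?_⟩
    · have := (tendsto_one_div_add_atTop_nhds_zero_nat (𝕜 := ℝ)).const_add 1
      rw [add_zero] at this
      have h2 := (continuous_ofReal.tendsto (1 : ℝ)).comp this
      rwa [ofReal_one] at h2
    · have : (0 : ℝ) < 1 / ((n : ℝ) + 1) := by positivity
      intro h
      have h' := ofReal_injective (h.trans ofReal_one.symm)
      linarith
  refine hlim.frequently (Frequently.of_forall fun n => ?_)
  exact hreal _ (by positivity)

theorem ofReal_mul_cpow {x : ℝ} (hx : 0 < x) (z s : ℂ) :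
    ((x : ℂ) * z) ^ s = (x : ℂ) ^ s * z ^ s := by
  have hx' : (x : ℂ) ≠ 0 := by exact_mod_cast hx.ne'
  rcases eq_or_ne z 0 with rfl | hz
  · rcases eq_or_ne s 0 with rfl | hs
    · simp
    · simp [zero_cpow hs]
  · rw [cpow_def_of_ne_zero (mul_ne_zero hx' hz), cpow_def_of_ne_zero hx', cpow_def_of_ne_zero hz,
      log_ofReal_mul hx hz, add_mul, exp_add, ofReal_log hx.le]

/-! ### The theta series of a diagonal form and its functional equation. -/

/-- The theta series `∑ exp (-π Q(n) z)` of the diagonal form `Q(n) = ∑ ξ_i n_i²`, as a product. -/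
noncomputable def diagTheta {k : ℕ} (ξ : Fin k → ℝ) (z : ℂ) : ℂ :=
  ∏ i, jacobiTheta (I * (ξ i * z))

/-- The diagonal form `∑ ξ_i n_i²`. -/
def diagForm {k : ℕ} (ξ : Fin k → ℝ) (n : Fin k → ℤ) : ℝ := ∑ i, ξ i * (n i : ℝ) ^ 2

theorem quadFormAt_diagonal {k : ℕ} (ξ : Fin k → ℝ) (n : Fin k → ℤ) :
    quadFormAt (Matrix.diagonal ξ) n = diagForm ξ n := by
  simp only [quadFormAt, diagForm, dotProduct, Matrix.mulVec_diagonal]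
  exact Finset.sum_congr rfl fun i _ => by ring

theorem exists_le_diagForm {k : ℕ} {ξ : Fin k → ℝ} (hξ : ∀ i, 0 < ξ i) :
    ∃ c : ℝ, 0 < c ∧ ∀ n : Fin k → ℤ, n ≠ 0 → c * (1 + ‖n‖) ^ 2 ≤ diagForm ξ n := by
  obtain ⟨a, ha, hle⟩ : ∃ a : ℝ, 0 < a ∧ ∀ i, a ≤ ξ i := by
    rcases isEmpty_or_nonempty (Fin k) with h | h
    · exact ⟨1, one_pos, fun i => (h.false i).elim⟩
    · obtain ⟨i, hi⟩ := Finite.exists_min ξ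
      exact ⟨ξ i, hξ i, hi⟩
  -- A non-zero integral vector has `1 + ‖n‖ ≤ 2 ‖n‖`, whence the `4`.
  refine ⟨a / 4, by positivity, fun n hn => ?_⟩
  have h1 : (1 : ℝ) ≤ ‖n‖ := by
    obtain ⟨i, hi⟩ := Function.ne_iff.1 hn
    refine le_trans ?_ (norm_le_pi_norm n i)
    rw [Int.norm_eq_abs]
    exact_mod_cast Int.one_le_abs hi
  have h2 : a * ‖n‖ ^ 2 ≤ diagForm ξ n := by
    have hk : Nonempty (Fin k) := by
      obtain ⟨i, -⟩ := Function.ne_iff.1 hn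
      exact ⟨i⟩
    obtain ⟨i, -, hi⟩ := Finset.exists_mem_eq_sup' Finset.univ_nonempty (fun i => ‖n i‖)
    have h3 : ‖n‖ ≤ ‖n i‖ := by
      refine (pi_norm_le_iff_of_nonneg (norm_nonneg _)).2 fun j => ?_
      rw [← hi]
      exact Finset.le_sup' (fun i => ‖n i‖) (Finset.mem_univ j)
    calc a * ‖n‖ ^ 2 ≤ ξ i * ‖n i‖ ^ 2 := by
          have := hle i
          have := (hξ i).le
          gcongr
      _ = ξ i * (n i : ℝ) ^ 2 := by rw [Int.norm_eq_abs, sq_abs]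
      _ ≤ diagForm ξ n :=
          Finset.single_le_sum (f := fun i => ξ i * (n i : ℝ) ^ 2)
            (fun j _ => by have := hξ j; positivity) (Finset.mem_univ i)
  have h5 : (1 + ‖n‖) ^ 2 ≤ 4 * ‖n‖ ^ 2 := by nlinarith
  nlinarith

theorem diagForm_pos {k : ℕ} {ξ : Fin k → ℝ} (hξ : ∀ i, 0 < ξ i) {n : Fin k → ℤ} (hn : n ≠ 0) :
    0 < diagForm ξ n := by
  obtain ⟨c, hc, h⟩ := exists_le_diagForm hξ
  exact lt_of_lt_of_le (by positivity) (h n hn)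

theorem summable_diagForm_rpow {k : ℕ} {ξ : Fin k → ℝ} (hξ : ∀ i, 0 < ξ i) {r : ℝ}
    (hr : (k : ℝ) / 2 < r) :
    Summable fun n : {n : Fin k → ℤ // n ≠ 0} => diagForm ξ n ^ (-r) := by
  obtain ⟨c, hc, h⟩ := exists_le_diagForm hξ
  have hr0 : 0 < r := lt_of_le_of_lt (by positivity) hr
  have h1 := ((summable_one_add_norm_rpow (k := k) (r := 2 * r) (by linarith)).mul_left
    (c ^ (-r))).subtype {n | n ≠ 0}
  refine Summable.of_nonneg_of_le (fun n => Real.rpow_nonneg (diagForm_pos hξ n.2).le _)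
    (fun n => ?_) h1
  calc diagForm ξ n ^ (-r) ≤ (c * (1 + ‖(n : Fin k → ℤ)‖) ^ 2) ^ (-r) :=
        Real.rpow_le_rpow_of_nonpos (by positivity) (h n n.2) (by linarith)
    _ = c ^ (-r) * (1 + ‖(n : Fin k → ℤ)‖) ^ (-(2 * r)) := by
        rw [Real.mul_rpow hc.le (by positivity), ← Real.rpow_natCast, ← Real.rpow_mul (by positivity)]
        norm_num

/-- Trading exponential for power decay reduces every theta estimate to the convergent sum of `Q(n)
^ (-r)` with `r > k / 2`, at the cost of an `ε` in the exponent. -/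
theorem exp_neg_le_mul_rpow {r : ℝ} (hr : 0 ≤ r) :
    ∃ C : ℝ, 0 < C ∧ ∀ y : ℝ, 0 < y → Real.exp (-y) ≤ C * y ^ (-r) := by
  refine ⟨(Nat.ceil r).factorial + 1, by positivity, fun y hy => ?_⟩
  have h1 := Real.pow_div_factorial_le_exp y hy.le (Nat.ceil r)
  have h2 := Real.one_le_exp hy.le
  have h3 : y ^ r ≤ ((Nat.ceil r).factorial + 1) * Real.exp y := by
    rcases le_total y 1 with h | h
    · have := Real.rpow_le_one hy.le h hr
      have h4 : (0 : ℝ) ≤ (Nat.ceil r).factorial := by positivity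
      nlinarith
    · have h5 : y ^ r ≤ y ^ (Nat.ceil r) := by
        rw [← Real.rpow_natCast]
        exact Real.rpow_le_rpow_of_exponent_le h (Nat.le_ceil r)
      rw [div_le_iff₀ (by positivity)] at h1
      nlinarith
  rw [Real.exp_neg, Real.rpow_neg hy.le, ← div_eq_mul_inv,
    le_div_iff₀ (Real.rpow_pos_of_pos hy _), inv_mul_le_iff₀ (Real.exp_pos _), mul_comm]
  exact h3

theorem jacobiTheta_term_eq (x : ℝ) (z : ℂ) (n : ℤ) :
    jacobiTheta₂_term n 0 (I * (x * z)) = exp (-(Real.pi * ((x * (n : ℝ) ^ 2 : ℝ) : ℂ) * z)) := by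
  rw [jacobiTheta₂_term]
  congr 1
  push_cast
  linear_combination (Real.pi * (n : ℂ) ^ 2 * x * z) * I_sq

theorem hasSum_diagTheta {k : ℕ} {ξ : Fin k → ℝ} (hξ : ∀ i, 0 < ξ i) {z : ℂ} (hz : 0 < z.re) :
    HasSum (fun n : Fin k → ℤ => exp (-(Real.pi * (diagForm ξ n : ℂ) * z))) (diagTheta ξ z) := by
  have him : ∀ i, 0 < (I * (ξ i * z)).im := fun i => by
    have := mul_pos (hξ i) hz
    simpa using this
  have h := (summable_norm_and_hasSum_pi_prod (k := k)
    (fun i n => jacobiTheta₂_term n 0 (I * (ξ i * z)))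
    (fun i => ((summable_jacobiTheta₂_term_iff 0 _).2 (him i)).norm)).2
  have h2 : ∏ i, ∑' n, jacobiTheta₂_term n 0 (I * (ξ i * z)) = diagTheta ξ z :=
    Finset.prod_congr rfl fun i _ => (jacobiTheta_eq_jacobiTheta₂ _).symm
  rw [h2] at h
  convert! h using 2 with n
  simp_rw [jacobiTheta_term_eq, ← exp_sum, diagForm]
  congr 1
  push_cast
  rw [Finset.sum_neg_distrib, Finset.mul_sum, Finset.sum_mul]

theorem hasSum_diagTheta_sub_one {k : ℕ} {ξ : Fin k → ℝ} (hξ : ∀ i, 0 < ξ i) {z : ℂ}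
    (hz : 0 < z.re) :
    HasSum (fun n : {n : Fin k → ℤ // n ≠ 0} => exp (-(Real.pi * (diagForm ξ n : ℂ) * z)))
      (diagTheta ξ z - 1) := by
  have h1 := (hasSum_diagTheta hξ hz).update 0 0
  have h2 := (hasSum_subtype_iff_of_support_subset (s := {n : Fin k → ℤ | n ≠ 0})
    (f := Function.update (fun n : Fin k → ℤ => exp (-(Real.pi * (diagForm ξ n : ℂ) * z))) 0 0)
    (fun n hn h0 => hn (by rw [h0, Function.update_self]))).2 h1
  have h0 : (0 : ℂ) - exp (-(Real.pi * (diagForm ξ (0 : Fin k → ℤ) : ℂ) * z)) + diagTheta ξ z =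
      diagTheta ξ z - 1 := by
    simp [diagForm]; ring
  rw [h0] at h2
  refine h2.congr_fun fun n => ?_
  rw [Function.comp_apply, Function.update_of_ne n.2]

theorem norm_exp_diagForm {k : ℕ} (ξ : Fin k → ℝ) (n : Fin k → ℤ) (z : ℂ) :
    ‖exp (-(Real.pi * (diagForm ξ n : ℂ) * z))‖ = Real.exp (-(Real.pi * diagForm ξ n * z.re)) := by
  rw [norm_exp, neg_re, ← ofReal_mul, re_ofReal_mul]

/-- Polynomial decay of `Θ - 1`, of any order greater than `k / 2`. -/
theorem norm_diagTheta_sub_one_le {k : ℕ} {ξ : Fin k → ℝ} (hξ : ∀ i, 0 < ξ i) {r : ℝ}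
    (hr : (k : ℝ) / 2 < r) :
    ∃ C : ℝ, 0 < C ∧ ∀ z : ℂ, 0 < z.re → ‖diagTheta ξ z - 1‖ ≤ C * z.re ^ (-r) := by
  have hr0 : 0 ≤ r := le_trans (by positivity) hr.le
  obtain ⟨C, hC, h⟩ := exp_neg_le_mul_rpow hr0
  have hs := summable_diagForm_rpow hξ hr
  refine ⟨C * Real.pi ^ (-r) * (∑' n : {n : Fin k → ℤ // n ≠ 0}, diagForm ξ n ^ (-r)) + 1, ?_,
    fun z hz => ?_⟩
  · have : 0 ≤ ∑' n : {n : Fin k → ℤ // n ≠ 0}, diagForm ξ n ^ (-r) :=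
      tsum_nonneg fun n => Real.rpow_nonneg (diagForm_pos hξ n.2).le _
    positivity
  have hterm : ∀ n : {n : Fin k → ℤ // n ≠ 0},
      ‖exp (-(Real.pi * (diagForm ξ n : ℂ) * z))‖ ≤
        C * Real.pi ^ (-r) * z.re ^ (-r) * diagForm ξ n ^ (-r) := by
    intro n
    have hn := diagForm_pos hξ n.2
    rw [norm_exp_diagForm]
    refine (h _ (by positivity)).trans (le_of_eq ?_)
    rw [Real.mul_rpow (by positivity) hz.le, Real.mul_rpow (by positivity) hn.le]
    ring
  have h1 := tsum_of_norm_bounded (hs.mul_left (C * Real.pi ^ (-r) * z.re ^ (-r))).hasSum hterm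
  rw [(hasSum_diagTheta_sub_one hξ hz).tsum_eq, tsum_mul_left] at h1
  refine h1.trans ?_
  have : 0 ≤ z.re ^ (-r) := Real.rpow_nonneg hz.le _
  nlinarith

/-- Joint continuity in the form and in `z` supplies the measurability needed for Tonelli's theorem.
-/
theorem continuousOn_diagTheta {k : ℕ} :
    ContinuousOn (fun p : (Fin k → ℝ) × ℂ => diagTheta p.1 p.2)
      {p | (∀ i, 0 < p.1 i) ∧ 0 < p.2.re} := by
  unfold diagTheta
  refine continuousOn_finsetProd _ fun i _ p hp => ContinuousAt.continuousWithinAt ?_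
  have him : 0 < (I * (p.1 i * p.2)).im := by
    have := mul_pos (hp.1 i) hp.2
    simpa using this
  exact ContinuousAt.comp (g := jacobiTheta) (f := fun p : (Fin k → ℝ) × ℂ => I * (p.1 i * p.2))
    (continuousAt_jacobiTheta him) (by fun_prop)

theorem jacobiTheta_I_mul_inv {u : ℂ} (hu : 0 < u.re) :
    jacobiTheta (I * u⁻¹) = u ^ (1 / 2 : ℂ) * jacobiTheta (I * u) := by
  have hu0 : u ≠ 0 := by rintro rfl; simp at hu
  have h := jacobiTheta₂_functional_equation 0 (I * u)
  have h1 : -I * (I * u) = u := by linear_combination -u * I_sq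
  have h2 : -1 / (I * u) = I * u⁻¹ := by
    field_simp
    linear_combination -I_sq
  rw [h1, h2] at h
  have hne : u ^ (1 / 2 : ℂ) ≠ 0 := by simp [cpow_eq_zero_iff, hu0]
  simp only [jacobiTheta_eq_jacobiTheta₂]
  rw [h]
  simp
  field_simp

/-- The functional equation of the theta series. -/
theorem diagTheta_inv_mul {k : ℕ} {ξ : Fin k → ℝ} (hξ : ∀ i, 0 < ξ i) {ω : ℂ} (hω : 0 < ω.re)
    {x : ℝ} (hx : 0 < x) :
    diagTheta ξ (((1 / x : ℝ) : ℂ) * ω) =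
      (∏ i, (((ξ i)⁻¹ : ℝ) * ω⁻¹ : ℂ) ^ (1 / 2 : ℂ)) * ((x ^ ((k : ℝ) / 2) : ℝ) : ℂ) *
        diagTheta ξ⁻¹ (x * ω⁻¹) := by
  have hω' : 0 < (ω⁻¹).re := by
    rw [inv_re]; exact div_pos hω (normSq_pos.2 (by rintro rfl; simp at hω))
  have hk : ((x ^ ((k : ℝ) / 2) : ℝ) : ℂ) = ∏ i : Fin k, (x : ℂ) ^ (1 / 2 : ℂ) := by
    rw [Finset.prod_const, Finset.card_univ, Fintype.card_fin, ← cpow_nat_mul, ofReal_cpow hx.le]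
    congr 1
    push_cast; ring
  rw [hk, ← Finset.prod_mul_distrib]
  unfold diagTheta
  rw [← Finset.prod_mul_distrib]
  refine Finset.prod_congr rfl fun i _ => ?_
  -- Each factor is transformed at `u = x / (ξ_i ω)`. The positive factor `x` comes out of the
  -- square root without a branch correction.
  have hu : 0 < (((x : ℂ) * (((ξ i)⁻¹ : ℝ) * ω⁻¹))).re := by
    rw [re_ofReal_mul, re_ofReal_mul]
    have := inv_pos.2 (hξ i)
    positivity
  have h := jacobiTheta_I_mul_inv hu
  rw [ofReal_mul_cpow hx] at h
  rw [mul_comm ((((ξ i)⁻¹ : ℝ) * ω⁻¹ : ℂ) ^ (1 / 2 : ℂ))]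
  convert! h using 3
  · push_cast
    simp only [mul_inv, inv_inv]
    ring
  · simp only [Pi.inv_apply]
    ring

/-! ### Analytic continuation from the Mellin transform along a ray. -/

theorem inv_re_pos {ω : ℂ} (hω : 0 < ω.re) : 0 < (ω⁻¹).re := by
  rw [inv_re]; exact div_pos hω (normSq_pos.2 (by rintro rfl; simp at hω))

/-- The root number in the functional equation of the rotated theta series. -/
noncomputable def thetaRootNumber {k : ℕ} (ξ : Fin k → ℝ) (ω : ℂ) : ℂ :=
  ∏ i, (((ξ i)⁻¹ : ℝ) * ω⁻¹ : ℂ) ^ (1 / 2 : ℂ)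

theorem continuousOn_diagTheta_ray {k : ℕ} {ξ : Fin k → ℝ} (hξ : ∀ i, 0 < ξ i) {ω : ℂ}
    (hω : 0 < ω.re) : ContinuousOn (fun x : ℝ => diagTheta ξ (x * ω)) (Ioi 0) := by
  refine (continuousOn_diagTheta (k := k)).comp (f := fun x : ℝ => (ξ, (x : ℂ) * ω))
    (by fun_prop) fun x hx => ⟨hξ, ?_⟩
  simp only [re_ofReal_mul]
  exact mul_pos hx hω

theorem isBigO_diagTheta_ray {k : ℕ} {ξ : Fin k → ℝ} (hξ : ∀ i, 0 < ξ i) {ω : ℂ}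
    (hω : 0 < ω.re) (r : ℝ) :
    (fun x : ℝ => diagTheta ξ (x * ω) - 1) =O[atTop] fun x : ℝ => x ^ r := by
  obtain ⟨N, hN⟩ := exists_gt (max ((k : ℝ) / 2) (-r))
  obtain ⟨C, hC, h⟩ := norm_diagTheta_sub_one_le hξ ((le_max_left _ _).trans_lt hN)
  refine Asymptotics.IsBigO.of_bound (C * ω.re ^ (-N)) ?_
  filter_upwards [eventually_ge_atTop 1] with x hx
  have hx0 : 0 < x := by linarith
  have h1 := h (x * ω) (by rw [re_ofReal_mul]; positivity)
  rw [re_ofReal_mul, Real.mul_rpow hx0.le hω.le] at h1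
  rw [Real.norm_of_nonneg (by positivity)]
  have h2 : x ^ (-N) ≤ x ^ r :=
    Real.rpow_le_rpow_of_exponent_le hx (by have := (le_max_right ((k : ℝ) / 2) (-r)).trans_lt hN; linarith)
  calc _ ≤ C * (x ^ (-N) * ω.re ^ (-N)) := h1
    _ ≤ C * (x ^ r * ω.re ^ (-N)) := by gcongr
    _ = _ := by ring

/-- The theta series on the ray through `ω` and its dual, as a pair of functions to which the
Mellin transform proof of the functional equation applies. -/
noncomputable def thetaPair {k : ℕ} (hk : 0 < k) (ξ : Fin k → ℝ) (hξ : ∀ i, 0 < ξ i) (ω : ℂ)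
    (hω : 0 < ω.re) : WeakFEPair ℂ where
  f x := diagTheta ξ (x * ω)
  g x := diagTheta ξ⁻¹ (x * ω⁻¹)
  k := (k : ℝ) / 2
  ε := thetaRootNumber ξ ω
  f₀ := 1
  g₀ := 1
  hf_int := (continuousOn_diagTheta_ray hξ hω).locallyIntegrableOn measurableSet_Ioi
  hg_int := (continuousOn_diagTheta_ray (fun i => inv_pos.2 (hξ i))
    (inv_re_pos hω)).locallyIntegrableOn measurableSet_Ioi
  hk := by positivity
  hε := by
    have hω0 : ω ≠ 0 := by rintro rfl; simp at hω
    refine Finset.prod_ne_zero_iff.2 fun i _ => ?_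
    have := (hξ i).ne'
    simp [cpow_eq_zero_iff, hω0, this]
  h_feq x hx := diagTheta_inv_mul hξ hω hx
  hf_top := isBigO_diagTheta_ray hξ hω
  hg_top := isBigO_diagTheta_ray (fun i => inv_pos.2 (hξ i)) (inv_re_pos hω)

/-- The Mellin transform is taken term by term: each `n` gives Euler's integral with parameter `π
Q(n) ω`. The integrals of the norms are a multiple of `Q(n) ^ (-Re w)`, summable for `Re w > k / 2`,
which justifies the interchange. -/
theorem hasSum_thetaPair_Λ {k : ℕ} (hk : 0 < k) {ξ : Fin k → ℝ} (hξ : ∀ i, 0 < ξ i) {ω : ℂ}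
    (hω : 0 < ω.re) {w : ℂ} (hw : (k : ℝ) / 2 < w.re) :
    HasSum (fun n : {n : Fin k → ℤ // n ≠ 0} =>
        (diagForm ξ n : ℂ) ^ (-w) * ((Real.pi * ω) ^ (-w) * Gamma w))
      ((thetaPair hk ξ hξ ω hω).Λ w) := by
  have hw0 : 0 < w.re := lt_of_le_of_lt (by positivity) hw
  have hM := ((thetaPair hk ξ hξ ω hω).hasMellin hw).2
  rw [← hM]
  have hpos : ∀ n : {n : Fin k → ℤ // n ≠ 0}, 0 < diagForm ξ n := fun n => diagForm_pos hξ n.2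
  have hre : ∀ n : {n : Fin k → ℤ // n ≠ 0}, 0 < (Real.pi * (diagForm ξ n : ℂ) * ω).re := fun n => by
    rw [← ofReal_mul, re_ofReal_mul]
    have := hpos n
    positivity
  have hnorm : ∀ (n : {n : Fin k → ℤ // n ≠ 0}) (t : ℝ), 0 < t →
      ‖(t : ℂ) ^ (w - 1) * exp (-(Real.pi * (diagForm ξ n : ℂ) * (t * ω)))‖ =
        t ^ (w.re - 1) * Real.exp (-(Real.pi * diagForm ξ n * ω.re * t)) := by
    intro n t ht
    rw [norm_mul, norm_cpow_eq_rpow_re_of_pos ht, norm_exp_diagForm, re_ofReal_mul, sub_re, one_re]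
    congr 3; ring
  have hcont : ∀ n : {n : Fin k → ℤ // n ≠ 0}, AEStronglyMeasurable (fun t : ℝ =>
      (t : ℂ) ^ (w - 1) * exp (-(Real.pi * (diagForm ξ n : ℂ) * (t * ω))))
      (volume.restrict (Ioi 0)) := by
    intro n
    refine ContinuousOn.aestronglyMeasurable ?_ measurableSet_Ioi
    refine ContinuousOn.mul ?_ (by fun_prop)
    exact continuousOn_of_forall_continuousAt fun t ht =>
      continuousAt_ofReal_cpow_const _ _ (Or.inr (ne_of_gt ht))
  have hmain := hasSum_integral_of_summable_integral_norm (μ := volume.restrict (Ioi (0 : ℝ)))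
    (F := fun (n : {n : Fin k → ℤ // n ≠ 0}) (t : ℝ) =>
      (t : ℂ) ^ (w - 1) * exp (-(Real.pi * (diagForm ξ n : ℂ) * (t * ω)))) ?_ ?_
  · convert! hmain using 1
    · ext n
      have h1 := integral_cpow_mul_exp_neg_mul_Ioi_of_re_pos hw0 (hre n)
      have h2 : (Real.pi * (diagForm ξ n : ℂ) * ω) ^ (-w) =
          (diagForm ξ n : ℂ) ^ (-w) * (Real.pi * ω) ^ (-w) := by
        rw [← ofReal_mul_cpow (hpos n)]
        congr 1; ring
      rw [← mul_assoc, ← h2, ← h1]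
      refine integral_congr_ae (ae_of_all _ fun t => ?_)
      simp only
      congr 3; ring
    · refine setIntegral_congr_fun measurableSet_Ioi fun t ht => ?_
      have ht0 : 0 < ((t : ℂ) * ω).re := by rw [re_ofReal_mul]; exact mul_pos ht hω
      have := ((hasSum_diagTheta_sub_one hξ ht0).mul_left ((t : ℂ) ^ (w - 1))).tsum_eq
      simpa [thetaPair] using this.symm
  · intro n
    refine (integrable_norm_iff (hcont n)).1 ?_
    have h1 := integrableOn_rpow_mul_exp_neg_mul_rpow (p := 1) (s := w.re - 1) (by linarith) one_pos
      (show 0 < Real.pi * diagForm ξ n * ω.re by have := hpos n; positivity)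
    refine h1.congr_fun (fun t ht => ?_) measurableSet_Ioi
    simp only [hnorm n t ht, Real.rpow_one, neg_mul]
  · have h3 : ∀ n : {n : Fin k → ℤ // n ≠ 0},
        ∫ t : ℝ in Ioi 0, ‖(t : ℂ) ^ (w - 1) * exp (-(Real.pi * (diagForm ξ n : ℂ) * (t * ω)))‖ =
          ((Real.pi * ω.re) ^ (-w.re) * Real.Gamma w.re) * diagForm ξ n ^ (-w.re) := by
      intro n
      have hn := hpos n
      rw [setIntegral_congr_fun measurableSet_Ioi (fun t ht => hnorm n t ht),
        Real.integral_rpow_mul_exp_neg_mul_Ioi hw0 (by positivity), one_div,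
        Real.inv_rpow (by positivity), ← Real.rpow_neg (by positivity),
        show Real.pi * diagForm ξ n * ω.re = Real.pi * ω.re * diagForm ξ n by ring,
        Real.mul_rpow (by positivity) hn.le]
      ring
    simp_rw [h3]
    exact (summable_diagForm_rpow hξ hw).mul_left _

/-- The continuation of the Epstein zeta-function obtained from the theta series on the ray
through `ω`, in terms of the variable `w = k s / 2`. -/
noncomputable def thetaContinuation {k : ℕ} (hk : 0 < k) (ξ : Fin k → ℝ) (hξ : ∀ i, 0 < ξ i)
    (ω : ℂ) (hω : 0 < ω.re) (w : ℂ) : ℂ :=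
  (Real.pi * ω) ^ w * ((thetaPair hk ξ hξ ω hω).Λ₀ w * (Gamma w)⁻¹ - (Gamma (w + 1))⁻¹ -
    thetaRootNumber ξ ω / ((k : ℂ) / 2 - w) * (Gamma w)⁻¹)

/-- The completed function `Λ` is `Λ₀` minus polar terms at `w = 0` and `w = k / 2`. Writing `1 / (w
Γ(w))` as `1 / Γ(w + 1)` removes the first pole, and only `w = k / 2`, that is `s = 1`, is left. -/
theorem isEpsteinContinuation_thetaContinuation {k : ℕ} (hk : 0 < k) (ξ : Fin k → ℝ)
    (hξ : ∀ i, 0 < ξ i) (ω : ℂ) (hω : 0 < ω.re) :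
    IsEpsteinContinuation (Matrix.diagonal ξ)
      (fun s => thetaContinuation hk ξ hξ ω hω ((k : ℂ) * s / 2)) := by
  have hω0 : (Real.pi * ω : ℂ) ≠ 0 := by
    have : ω ≠ 0 := by rintro rfl; simp at hω
    simp [this, Real.pi_ne_zero]
  have hk0 : (k : ℂ) ≠ 0 := by exact_mod_cast hk.ne'
  constructor
  · intro s hs
    have hs : s ≠ 1 := hs
    refine DifferentiableAt.differentiableWithinAt ?_
    have hd : DifferentiableAt ℂ (thetaContinuation hk ξ hξ ω hω) ((k : ℂ) * s / 2) := by
      have hG : Differentiable ℂ fun w : ℂ => (Gamma w)⁻¹ := differentiable_one_div_Gamma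
      have hG1 : Differentiable ℂ fun w : ℂ => (Gamma (w + 1))⁻¹ :=
        hG.comp (differentiable_id.add_const 1)
      have hne : (k : ℂ) / 2 - (k : ℂ) * s / 2 ≠ 0 := by
        rw [← sub_div, ← mul_one_sub]
        have : 1 - s ≠ 0 := sub_ne_zero.2 hs.symm
        exact div_ne_zero (mul_ne_zero hk0 this) two_ne_zero
      unfold thetaContinuation
      refine DifferentiableAt.mul ?_ (((((thetaPair hk ξ hξ ω hω).differentiable_Λ₀ _).mul (hG _)).sub
        (hG1 _)).sub (DifferentiableAt.mul ?_ (hG _)))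
      · exact (differentiableAt_id).const_cpow (Or.inl hω0)
      · exact (differentiableAt_const _).div (by fun_prop) hne
    exact hd.comp s (f := fun s : ℂ => (k : ℂ) * s / 2) (by fun_prop)
  · intro s hs
    set w : ℂ := (k : ℂ) * s / 2 with hw
    have hwre : (k : ℝ) / 2 < w.re := by
      have : w.re = k * s.re / 2 := by simp [hw]
      rw [this]
      have : (0 : ℝ) < k := by exact_mod_cast hk
      nlinarith
    have hw0 : 0 < w.re := lt_of_le_of_lt (by positivity) hwre
    have hwne : w ≠ 0 := by intro h; rw [h] at hw0; simp at hw0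
    have hΓ : Gamma w ≠ 0 := Gamma_ne_zero_of_re_pos hw0
    have h := (hasSum_thetaPair_Λ hk hξ hω hwre).mul_right ((Real.pi * ω) ^ w * (Gamma w)⁻¹)
    have hc : (Real.pi * ω) ^ (-w) * Gamma w * ((Real.pi * ω) ^ w * (Gamma w)⁻¹) = 1 := by
      rw [cpow_neg]
      have : (Real.pi * ω) ^ w ≠ 0 := by simp [cpow_eq_zero_iff, hω0]
      field_simp
    simp_rw [mul_assoc ((diagForm ξ _ : ℂ) ^ (-w)), hc, mul_one] at h
    simp_rw [quadFormAt_diagonal]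
    convert! h using 1
    have hΛ := (thetaPair hk ξ hξ ω hω).Λ₀_eq w
    have h1 : (Gamma (w + 1))⁻¹ = w⁻¹ * (Gamma w)⁻¹ := by rw [Gamma_add_one w hwne, mul_inv]
    rw [thetaContinuation, hΛ, h1]
    simp only [thetaPair, smul_eq_mul]
    push_cast
    ring

theorem isEpsteinContinuation_epsteinZeta {k : ℕ} (hk : 0 < k) {ξ : Fin k → ℝ}
    (hξ : ∀ i, 0 < ξ i) :
    IsEpsteinContinuation (Matrix.diagonal ξ) (epsteinZeta (Matrix.diagonal ξ)) :=
  Classical.epsilon_spec (p := IsEpsteinContinuation (Matrix.diagonal ξ))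
    ⟨_, isEpsteinContinuation_thetaContinuation hk ξ hξ 1 (by simp)⟩

/-- The left side does not involve `ω`, so the ray may be chosen afresh for each range of `t`. -/
theorem epsteinZeta_eq_thetaContinuation {k : ℕ} (hk : 0 < k) {ξ : Fin k → ℝ}
    (hξ : ∀ i, 0 < ξ i) {ω : ℂ} (hω : 0 < ω.re) {s : ℂ} (hs : s ≠ 1) :
    epsteinZeta (Matrix.diagonal ξ) s = thetaContinuation hk ξ hξ ω hω ((k : ℂ) * s / 2) :=
  (isEpsteinContinuation_epsteinZeta hk hξ).eqOn
    (isEpsteinContinuation_thetaContinuation hk ξ hξ ω hω) hs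

/-! ### Theta tails and the bound on the critical line. -/

/-- The part of the rotated theta series on `(1, ∞)`, with the constant term removed. -/
noncomputable def thetaTail {k : ℕ} (ξ : Fin k → ℝ) (ω : ℂ) : ℝ → ℂ :=
  (Ioi 1).indicator fun x => diagTheta ξ (x * ω) - 1

theorem locallyIntegrableOn_thetaTail {k : ℕ} {ξ : Fin k → ℝ} (hξ : ∀ i, 0 < ξ i) {ω : ℂ}
    (hω : 0 < ω.re) : LocallyIntegrableOn (thetaTail ξ ω) (Ioi 0) := by
  intro x hx
  obtain ⟨s, hs, hs'⟩ := ((continuousOn_diagTheta_ray hξ hω).sub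
    (continuousOn_const (c := (1 : ℂ)))).locallyIntegrableOn (μ := volume) measurableSet_Ioi x hx
  exact ⟨s, hs, hs'.indicator measurableSet_Ioi⟩

theorem isBigO_thetaTail_atTop {k : ℕ} {ξ : Fin k → ℝ} (hξ : ∀ i, 0 < ξ i) {ω : ℂ}
    (hω : 0 < ω.re) (r : ℝ) : thetaTail ξ ω =O[atTop] fun x : ℝ => x ^ r := by
  refine (isBigO_diagTheta_ray hξ hω r).congr' ?_ .rfl
  filter_upwards [eventually_gt_atTop 1] with x hx
  rw [thetaTail, indicator_of_mem (mem_Ioi.2 hx)]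

theorem isBigO_thetaTail_zero {k : ℕ} (ξ : Fin k → ℝ) (ω : ℂ) (r : ℝ) :
    thetaTail ξ ω =O[𝓝[>] 0] fun x : ℝ => x ^ r := by
  refine Asymptotics.IsBigO.of_bound 0 ?_
  filter_upwards [mem_nhdsWithin_of_mem_nhds (Iio_mem_nhds one_pos)] with x hx
  rw [thetaTail, indicator_of_notMem (by simpa using le_of_lt hx)]
  simp

theorem mellinConvergent_thetaTail {k : ℕ} {ξ : Fin k → ℝ} (hξ : ∀ i, 0 < ξ i) {ω : ℂ}
    (hω : 0 < ω.re) (w : ℂ) : MellinConvergent (thetaTail ξ ω) w :=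
  let ⟨_, ha⟩ := exists_gt w.re
  let ⟨_, hb⟩ := exists_lt w.re
  mellinConvergent_of_isBigO_rpow (locallyIntegrableOn_thetaTail hξ hω)
    (isBigO_thetaTail_atTop hξ hω _) ha (isBigO_thetaTail_zero ξ ω _) hb

theorem differentiable_mellin_thetaTail {k : ℕ} {ξ : Fin k → ℝ} (hξ : ∀ i, 0 < ξ i) {ω : ℂ}
    (hω : 0 < ω.re) : Differentiable ℂ (mellin (thetaTail ξ ω)) := fun w =>
  let ⟨_, ha⟩ := exists_gt w.re
  let ⟨_, hb⟩ := exists_lt w.re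
  mellin_differentiableAt_of_isBigO_rpow (locallyIntegrableOn_thetaTail hξ hω)
    (isBigO_thetaTail_atTop hξ hω _) ha (isBigO_thetaTail_zero ξ ω _) hb

/-- The part over `(0, 1)` is folded onto `(1, ∞)` by `x ↦ 1 / x` and the functional equation, which
turns it into the tail of the dual form on the inverse ray. -/
theorem thetaPair_Λ₀_eq {k : ℕ} (hk : 0 < k) {ξ : Fin k → ℝ} (hξ : ∀ i, 0 < ξ i) {ω : ℂ}
    (hω : 0 < ω.re) (w : ℂ) :
    (thetaPair hk ξ hξ ω hω).Λ₀ w =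
      mellin (thetaTail ξ ω) w + thetaRootNumber ξ ω * mellin (thetaTail ξ⁻¹ ω⁻¹) ((k : ℂ) / 2 - w) := by
  have hξ' : ∀ i, 0 < ξ⁻¹ i := fun i => inv_pos.2 (hξ i)
  have hω' := inv_re_pos hω
  set B : ℝ → ℂ := fun x => thetaRootNumber ξ ω • ((x : ℂ) ^ (-(k : ℂ) / 2) • thetaTail ξ⁻¹ ω⁻¹ x⁻¹)
    with hB
  have hmodif : ∀ x ∈ Ioi (0 : ℝ), (thetaPair hk ξ hξ ω hω).f_modif x = thetaTail ξ ω x + B x := by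
    intro x hx
    have hx : 0 < x := hx
    have hpow : (x : ℂ) ^ (-(k : ℂ) / 2) = ((x ^ (-((k : ℝ) / 2)) : ℝ) : ℂ) := by
      rw [ofReal_cpow hx.le]; congr 1; push_cast; ring
    simp only [WeakFEPair.f_modif, Pi.add_apply, thetaTail, thetaPair, hB]
    congr 1
    by_cases h1 : x < 1
    · have h2 : (1 : ℝ) < x⁻¹ := (one_lt_inv₀ hx).2 h1
      have h3 := diagTheta_inv_mul hξ hω (inv_pos.2 hx)
      rw [one_div, inv_inv, Real.inv_rpow hx.le, ← Real.rpow_neg hx.le] at h3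
      rw [indicator_of_mem (mem_Ioo.2 ⟨hx, h1⟩), indicator_of_mem (mem_Ioi.2 h2), h3, hpow,
        thetaRootNumber]
      simp only [smul_eq_mul]
      ring
    · rw [indicator_of_notMem (by simp [h1]), indicator_of_notMem]
      · simp
      · simp only [mem_Ioi, not_lt] at h1 ⊢
        exact inv_le_one_of_one_le₀ h1
  have hMB : mellin B w = thetaRootNumber ξ ω * mellin (thetaTail ξ⁻¹ ω⁻¹) ((k : ℂ) / 2 - w) := by
    rw [hB, mellin_const_smul, mellin_cpow_smul (fun x => thetaTail ξ⁻¹ ω⁻¹ x⁻¹), mellin_comp_inv,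
      smul_eq_mul]
    congr 2; ring
  have hcB : MellinConvergent B w := by
    refine MellinConvergent.const_smul ?_ _
    rw [MellinConvergent.cpow_smul]
    simp_rw [← Real.rpow_neg_one]
    refine (MellinConvergent.comp_rpow (by norm_num)).2 ?_
    exact mellinConvergent_thetaTail hξ' hω' _
  rw [← hMB, ← (hasMellin_add (mellinConvergent_thetaTail hξ hω w) hcB).2, WeakFEPair.Λ₀]
  exact setIntegral_congr_fun measurableSet_Ioi fun x hx => by simp only [hmodif x hx]

theorem norm_thetaRootNumber {k : ℕ} {ξ : Fin k → ℝ} (hξ : ∀ i, 0 < ξ i) {ω : ℂ} (hω : ‖ω‖ = 1) :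
    ‖thetaRootNumber ξ ω‖ = ∏ i, (ξ i) ^ (-(1 / 2) : ℝ) := by
  rw [thetaRootNumber, norm_prod]
  refine Finset.prod_congr rfl fun i _ => ?_
  have h := hξ i
  have h2 : ((1 / 2 : ℂ)) = ((1 / 2 : ℝ) : ℂ) := by push_cast; rfl
  rw [h2, norm_cpow_real, norm_mul, norm_inv, hω, norm_real, Real.norm_of_nonneg (by positivity),
    inv_one, mul_one, Real.inv_rpow h.le, Real.rpow_neg h.le]

/-- The Epstein zeta-function on the critical line, in terms of the two theta integrals. -/
theorem norm_epsteinZeta_le {k : ℕ} (hk : 2 ≤ k) {ξ : Fin k → ℝ} (hξ : ∀ i, 0 < ξ i) {ω : ℂ}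
    (hω : 0 < ω.re) (hω1 : ‖ω‖ = 1) {t : ℝ} (ht : 1 ≤ t) :
    ‖epsteinZeta (Matrix.diagonal ξ) (1 / 2 + t * I)‖ ≤
      Real.pi ^ ((k : ℝ) / 4) * Real.exp (-(arg ω * (k * t / 2))) *
        ‖Gamma (((k : ℝ) / 4 : ℝ) + (k * t / 2 : ℝ) * I)‖⁻¹ *
        ((1 + ∏ i, (ξ i) ^ (-(1 / 2) : ℝ)) *
        (‖mellin (thetaTail ξ ω) (((k : ℝ) / 4 : ℝ) + (k * t / 2 : ℝ) * I)‖ +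
          ‖mellin (thetaTail ξ⁻¹ ω⁻¹) (((k : ℝ) / 4 : ℝ) + (-(k * t / 2) : ℝ) * I)‖ + 1)) := by
  have hk0 : 0 < k := by omega
  have hs : (1 / 2 + t * I : ℂ) ≠ 1 := by
    intro h
    have := congrArg re h
    norm_num at this
  set w : ℂ := ((k : ℝ) / 4 : ℝ) + (k * t / 2 : ℝ) * I with hw
  have hw1 : (k : ℂ) * (1 / 2 + t * I) / 2 = w := by rw [hw]; push_cast; ring
  have hw2 : (k : ℂ) / 2 - w = ((k : ℝ) / 4 : ℝ) + (-(k * t / 2) : ℝ) * I := by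
    rw [hw]; push_cast; ring
  have hkr : (2 : ℝ) ≤ k := by exact_mod_cast hk
  have hwre : w.re = (k : ℝ) / 4 := by simp [hw]
  have hwim : w.im = k * t / 2 := by simp [hw]
  -- Since `Im w = k t / 2 ≥ 1`, the two polar terms are at most `1` and `P`, the norm of the root
  -- number.
  have hwn : 1 ≤ ‖w‖ := by
    refine le_trans ?_ (abs_im_le_norm w)
    rw [hwim, abs_of_nonneg (by positivity)]
    nlinarith
  have hwne : w ≠ 0 := by intro h; rw [h] at hwn; norm_num at hwn
  have hwn2 : 1 ≤ ‖(k : ℂ) / 2 - w‖ := by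
    refine le_trans ?_ (abs_im_le_norm _)
    rw [hw2]
    simp only [add_im, ofReal_im, im_ofReal_mul, I_im, zero_add, mul_one, abs_neg]
    rw [abs_of_nonneg (by positivity)]
    nlinarith
  have hω0 : ω ≠ 0 := by rintro rfl; simp at hω
  -- The factor `exp (-arg ω Im w)` is the gain from rotating the ray; it will be set against the
  -- growth of `1 / Γ(w)`.
  have hpow : ‖(Real.pi * ω : ℂ) ^ w‖ = Real.pi ^ ((k : ℝ) / 4) * Real.exp (-(arg ω * (k * t / 2))) := by
    rw [ofReal_mul_cpow Real.pi_pos, norm_mul, norm_cpow_eq_rpow_re_of_pos Real.pi_pos, hwre,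
      norm_cpow_of_ne_zero hω0, hω1, Real.one_rpow, hwim, one_div, Real.exp_neg]
  rw [epsteinZeta_eq_thetaContinuation hk0 hξ hω hs, hw1, thetaContinuation, norm_mul, hpow,
    mul_assoc (_ * _) (‖Gamma w‖⁻¹)]
  gcongr
  rw [Gamma_add_one w hwne, mul_inv, ← sub_mul, ← sub_mul, norm_mul, norm_inv, mul_comm]
  gcongr
  rw [thetaPair_Λ₀_eq, hw2]
  rw [hw2] at hwn2
  set A := mellin (thetaTail ξ ω) w
  set A' := mellin (thetaTail ξ⁻¹ ω⁻¹) (((k : ℝ) / 4 : ℝ) + (-(k * t / 2) : ℝ) * I)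
  have hε := norm_thetaRootNumber hξ hω1
  set P := ∏ i, (ξ i) ^ (-(1 / 2) : ℝ)
  set ε := thetaRootNumber ξ ω
  have hP : 0 ≤ P := hε ▸ norm_nonneg _
  have h1 : ‖w⁻¹‖ ≤ 1 := by rw [norm_inv]; exact inv_le_one_of_one_le₀ hwn
  have h2 : ‖ε / (((k : ℝ) / 4 : ℝ) + (-(k * t / 2) : ℝ) * I)‖ ≤ P := by
    rw [norm_div, hε]; exact div_le_self hP hwn2
  calc _ ≤ ‖A‖ + ‖ε * A'‖ + ‖w⁻¹‖ + ‖ε / (((k : ℝ) / 4 : ℝ) + (-(k * t / 2) : ℝ) * I)‖ := by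
        refine (norm_sub_le _ _).trans ?_
        gcongr
        refine (norm_sub_le _ _).trans ?_
        gcongr
        exact norm_add_le _ _
    _ ≤ ‖A‖ + P * ‖A'‖ + 1 + P := by rw [norm_mul, hε]; gcongr
    _ ≤ _ := by nlinarith [norm_nonneg A, norm_nonneg A', mul_nonneg hP (norm_nonneg A)]

/-! ### Plancherel and Cauchy-Schwarz for the Mellin transform. -/

-- Both transforms are tested against smooth compactly supported functions; in each case the Fourier
-- transform moves onto the test function.
open FourierTransform SchwartzMap in
theorem fourier_toLp_ae_eq {f : ℝ → ℂ} (hf : Integrable f) (hf2 : MemLp f 2) :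
    (𝓕 (hf2.toLp f) : Lp ℂ 2 (volume : Measure ℝ)) =ᵐ[volume] 𝓕 f := by
  have hcont : Continuous (𝓕 f) := by
    exact VectorFourier.fourierIntegral_continuous Real.continuous_fourierChar
      (L := innerₗ ℝ) continuous_inner hf
  refine ae_eq_of_integral_contDiff_smul_eq
    ((Lp.memLp _).locallyIntegrable (by norm_num)) hcont.locallyIntegrable fun g hg hgc => ?_
  have hGc : HasCompactSupport (fun x => (g x : ℂ)) := hgc.comp_left ofReal_zero
  have hGd : ContDiff ℝ ((⊤ : ℕ∞) : WithTop ℕ∞) (fun x => (g x : ℂ)) :=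
    ofRealCLM.contDiff.comp hg
  set G : 𝓢(ℝ, ℂ) := hGc.toSchwartzMap hGd with hG
  have hGx : ∀ x, G x = (g x : ℂ) := fun x => rfl
  have h1 := DFunLike.congr_fun (Lp.fourier_toTemperedDistribution_eq (hf2.toLp f)) G
  rw [TemperedDistribution.fourier_apply, Lp.toTemperedDistribution_apply,
    Lp.toTemperedDistribution_apply] at h1
  have h2 : ∀ x : ℝ, g x • (𝓕 (hf2.toLp f) : Lp ℂ 2 (volume : Measure ℝ)) x =
      G x • (𝓕 (hf2.toLp f) : Lp ℂ 2 (volume : Measure ℝ)) x := fun x => by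
    rw [hGx, real_smul, smul_eq_mul]
  have h3 : ∀ x : ℝ, g x • 𝓕 f x = G x • 𝓕 f x := fun x => by
    rw [hGx, real_smul, smul_eq_mul]
  simp_rw [h2, h3]
  rw [← h1]
  have h4 : ∫ x, (𝓕 G) x • (hf2.toLp f) x = ∫ x, (𝓕 G) x • f x := by
    refine integral_congr_ae ?_
    filter_upwards [hf2.coeFn_toLp] with x hx
    rw [hx]
  rw [h4]
  have h5 := VectorFourier.integral_fourierIntegral_smul_eq_flip (L := innerₗ ℝ)
    (μ := volume) (ν := volume) Real.continuous_fourierChar continuous_inner G.integrable hf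
  rw [flip_innerₗ] at h5
  exact h5

-- For `f` in `L¹ ∩ L²` this is Plancherel, and otherwise the right-hand side is infinite.
open FourierTransform in
theorem lintegral_fourier_sq_le {f : ℝ → ℂ} (hf : Integrable f) :
    ∫⁻ x, ‖𝓕 f x‖ₑ ^ 2 ≤ ∫⁻ x, ‖f x‖ₑ ^ 2 := by
  have key : ∀ g : ℝ → ℂ, eLpNorm g 2 volume ^ 2 = ∫⁻ x, ‖g x‖ₑ ^ 2 := by
    intro g
    rw [eLpNorm_eq_lintegral_rpow_enorm_toReal (by norm_num) (by norm_num), ← ENNReal.rpow_natCast,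
      ← ENNReal.rpow_mul]
    norm_num
  rcases eq_or_ne (∫⁻ x, ‖f x‖ₑ ^ 2) ⊤ with h | h
  · rw [h]; exact le_top
  have hf2 : MemLp f 2 := by
    refine ⟨hf.1, ?_⟩
    by_contra h'
    rw [← key, not_lt_top_iff.1 h'] at h
    exact h (by simp)
  have h1 := Lp.norm_fourier_eq (hf2.toLp f)
  rw [Lp.norm_def, Lp.norm_def, ENNReal.toReal_eq_toReal_iff' (Lp.eLpNorm_ne_top _)
    (Lp.eLpNorm_ne_top _), eLpNorm_congr_ae (fourier_toLp_ae_eq hf hf2),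
    eLpNorm_congr_ae hf2.coeFn_toLp] at h1
  rw [← key, ← key, h1]

theorem lintegral_comp_div_const (g : ℝ → ENNReal) {c : ℝ} (hc : c ≠ 0) :
    ∫⁻ x, g (x / c) = ENNReal.ofReal |c| * ∫⁻ x, g x := by
  have h := lintegral_image_eq_lintegral_abs_deriv_mul (s := univ) (f := fun x : ℝ => x / c)
    (f' := fun _ => 1 / c) MeasurableSet.univ
    (fun x _ => ((hasDerivAt_id x).div_const c).hasDerivWithinAt)
    (fun x _ y _ hxy => (div_left_inj' hc).1 hxy) g
  have hs : (fun x : ℝ => x / c) '' univ = univ := by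
    rw [image_univ]
    exact range_eq_univ.2 (fun y => ⟨y * c, by field_simp⟩ : Function.Surjective fun x : ℝ => x / c)
  rw [hs, Measure.restrict_univ, lintegral_const_mul' _ _ ENNReal.ofReal_ne_top] at h
  rw [h, ← mul_assoc, ← ENNReal.ofReal_mul (abs_nonneg c), ← abs_mul, mul_one_div_cancel hc, abs_one,
    ENNReal.ofReal_one, one_mul]

open FourierTransform in
/-- The Bessel inequality for the Mellin transform on a vertical line. -/
theorem lintegral_mellin_sq_le {f : ℝ → ℂ} {σ : ℝ} (hf : MellinConvergent f σ) :
    ∫⁻ τ : ℝ, ‖mellin f (σ + τ * I)‖ₑ ^ 2 ≤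
      ENNReal.ofReal (2 * Real.pi) *
        ∫⁻ x in Ioi 0, ‖f x‖ₑ ^ 2 * ENNReal.ofReal (x ^ (2 * σ - 1)) := by
  -- With `x = exp (-u)` the Mellin transform at `σ + iτ` is the Fourier transform of `h` at `τ /
  -- 2π`; rescaling the frequency produces the factor `2π`.
  set h : ℝ → ℂ := fun u => Real.exp (-σ * u) • f (Real.exp (-u)) with hh
  have hderiv : ∀ x ∈ (univ : Set ℝ),
      HasDerivWithinAt (fun u => Real.exp (-u)) (-Real.exp (-x)) univ x := fun x _ => by
    simpa using (hasDerivAt_neg x).exp.hasDerivWithinAt (s := univ)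
  have hinj : InjOn (fun u => Real.exp (-u)) univ := fun x _ y _ hxy =>
    neg_injective (Real.exp_injective hxy)
  have himage : (fun u => Real.exp (-u)) '' univ = Ioi 0 := by
    rw [show (fun u => Real.exp (-u)) = Real.exp ∘ Neg.neg from rfl, image_comp,
      image_univ_of_surjective neg_surjective, image_univ, Real.range_exp]
  have hhint : Integrable h := by
    rw [MellinConvergent, ← himage, integrableOn_image_iff_integrableOn_abs_deriv_smul
      MeasurableSet.univ hderiv hinj, integrableOn_univ] at hf
    refine hf.congr (ae_of_all _ fun u => ?_)
    have h1 : ((Real.exp (-u) : ℝ) : ℂ) ^ ((σ : ℂ) - 1) = ((Real.exp (-u) ^ (σ - 1) : ℝ) : ℂ) := by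
      rw [ofReal_cpow (Real.exp_pos _).le]; push_cast; rfl
    simp only [hh, h1, abs_neg, abs_of_pos (Real.exp_pos _), real_smul, smul_eq_mul]
    rw [← mul_assoc, ← ofReal_mul, ← Real.exp_mul, ← Real.exp_add]
    congr 3; ring
  have hmel : ∀ τ : ℝ, mellin f (σ + τ * I) = 𝓕 h (τ / (2 * Real.pi)) := fun τ => by
    rw [mellin_eq_fourier]; simp [hh]
  simp_rw [hmel]
  rw [lintegral_comp_div_const (fun x => ‖𝓕 h x‖ₑ ^ 2) (by positivity),
    abs_of_pos (by positivity)]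
  refine mul_le_mul_right ?_ _
  refine (lintegral_fourier_sq_le hhint).trans (le_of_eq ?_)
  rw [← himage, lintegral_image_eq_lintegral_abs_deriv_mul MeasurableSet.univ hderiv hinj,
    Measure.restrict_univ]
  refine lintegral_congr fun u => ?_
  rw [hh]
  simp only [abs_neg, abs_of_pos (Real.exp_pos _), real_smul]
  rw [enorm_mul, mul_pow, mul_comm (ENNReal.ofReal _), mul_assoc, mul_comm, ← ofReal_norm (Real.exp (-σ * u) : ℂ),
    norm_real, Real.norm_of_nonneg (Real.exp_pos _).le, ← ENNReal.ofReal_pow (Real.exp_pos _).le,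
    ← ENNReal.ofReal_mul (by positivity), ← Real.exp_mul, ← Real.exp_add, ← Real.exp_nat_mul]
  congr 3
  push_cast; ring

/-- The weighted mean square of a theta series on the ray through `ω`. -/
noncomputable def thetaMean {k : ℕ} (ξ : Fin k → ℝ) (ω : ℂ) (δ : ℝ) : ENNReal :=
  ∫⁻ x in Ioi (1 : ℝ), ‖diagTheta ξ (x * ω) - 1‖ₑ ^ 2 *
    ENNReal.ofReal (x ^ ((k : ℝ) / 2 - 1 + δ))

/-- On `Re w = k / 4` the natural weight is `x ^ (k/2 - 1)`. The extra `x ^ δ ≥ 1` is inserted so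
that the same mean serves the pointwise bound. -/
theorem lintegral_mellin_thetaTail_sq_le {k : ℕ} {ξ : Fin k → ℝ} (hξ : ∀ i, 0 < ξ i) {ω : ℂ}
    (hω : 0 < ω.re) {δ : ℝ} (hδ : 0 ≤ δ) :
    ∫⁻ τ : ℝ, ‖mellin (thetaTail ξ ω) (((k : ℝ) / 4 : ℝ) + τ * I)‖ₑ ^ 2 ≤
      ENNReal.ofReal (2 * Real.pi) * thetaMean ξ ω δ := by
  refine (lintegral_mellin_sq_le (mellinConvergent_thetaTail hξ hω _)).trans ?_
  gcongr
  have h1 : ∀ x : ℝ, ‖thetaTail ξ ω x‖ₑ ^ 2 * ENNReal.ofReal (x ^ (2 * ((k : ℝ) / 4) - 1)) =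
      (Ioi (1 : ℝ)).indicator (fun x : ℝ => ‖diagTheta ξ (x * ω) - 1‖ₑ ^ 2 *
        ENNReal.ofReal (x ^ (2 * ((k : ℝ) / 4) - 1))) x := fun x => by
    by_cases hx : x ∈ Ioi (1 : ℝ)
    · rw [thetaTail, indicator_of_mem hx, indicator_of_mem hx]
    · rw [thetaTail, indicator_of_notMem hx, indicator_of_notMem hx]; simp
  simp_rw [h1]
  rw [lintegral_indicator measurableSet_Ioi]
  rw [Measure.restrict_restrict measurableSet_Ioi, inter_eq_left.2 (Ioi_subset_Ioi zero_le_one)]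
  refine setLIntegral_mono' measurableSet_Ioi fun x hx => ?_
  refine mul_le_mul_right (ENNReal.ofReal_le_ofReal ?_) _
  exact Real.rpow_le_rpow_of_exponent_le (le_of_lt hx) (by linarith)

/-- Cauchy-Schwarz with `x ^ (k/4 - 1) = x ^ ((k/2 - 1 + δ)/2) * x ^ ((-1 - δ)/2)`; the square of
the last factor has integral `1 / δ` over `(1, ∞)`. -/
theorem enorm_mellin_thetaTail_sq_le {k : ℕ} {ξ : Fin k → ℝ} (hξ : ∀ i, 0 < ξ i) {ω : ℂ}
    (hω : 0 < ω.re) {δ : ℝ} (hδ : 0 < δ) (τ : ℝ) :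
    ‖mellin (thetaTail ξ ω) (((k : ℝ) / 4 : ℝ) + τ * I)‖ₑ ^ 2 ≤
      thetaMean ξ ω δ * ENNReal.ofReal (1 / δ) := by
  set w : ℂ := ((k : ℝ) / 4 : ℝ) + τ * I with hw
  have hwre : w.re = (k : ℝ) / 4 := by simp [hw]
  set F : ℝ → ℂ := fun x => diagTheta ξ (x * ω) - 1 with hF
  have hmeas : AEMeasurable (fun x => ‖F x‖ₑ * ENNReal.ofReal (x ^ (((k : ℝ) / 2 - 1 + δ) / 2)))
      (volume.restrict (Ioi 1)) := by
    have hc : ContinuousOn F (Ioi 1) :=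
      ((continuousOn_diagTheta_ray hξ hω).mono (Ioi_subset_Ioi zero_le_one)).sub continuousOn_const
    refine AEMeasurable.mul (hc.aestronglyMeasurable measurableSet_Ioi).enorm ?_
    exact (by fun_prop : Measurable _).aemeasurable
  have h1 : ‖mellin (thetaTail ξ ω) w‖ₑ ≤ ∫⁻ x in Ioi (1 : ℝ),
      (‖F x‖ₑ * ENNReal.ofReal (x ^ (((k : ℝ) / 2 - 1 + δ) / 2))) *
        ENNReal.ofReal (x ^ ((-1 - δ) / 2)) := by
    refine (enorm_integral_le_lintegral_enorm _).trans (le_of_eq ?_)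
    have h2 : ∀ x : ℝ, ‖(x : ℂ) ^ (w - 1) • thetaTail ξ ω x‖ₑ = (Ioi (1 : ℝ)).indicator (fun x : ℝ =>
        (‖F x‖ₑ * ENNReal.ofReal (x ^ (((k : ℝ) / 2 - 1 + δ) / 2))) *
          ENNReal.ofReal (x ^ ((-1 - δ) / 2))) x := fun x => by
      by_cases hx : x ∈ Ioi (1 : ℝ)
      · have hx0 : 0 < x := zero_lt_one.trans hx
        rw [thetaTail, indicator_of_mem hx, indicator_of_mem hx, enorm_smul, mul_assoc,
          ← ENNReal.ofReal_mul (by positivity), ← Real.rpow_add hx0, ← ofReal_norm ((x : ℂ) ^ _),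
          norm_cpow_eq_rpow_re_of_pos hx0, mul_comm, sub_re, hwre, one_re]
        congr 3; ring
      · rw [thetaTail, indicator_of_notMem hx, indicator_of_notMem hx]; simp
    simp_rw [h2]
    rw [lintegral_indicator measurableSet_Ioi, Measure.restrict_restrict measurableSet_Ioi,
      inter_eq_left.2 (Ioi_subset_Ioi zero_le_one)]
  have hsq : ∀ a : ENNReal, a ^ (2 : ℝ) = a ^ 2 := fun a => by
    rw [← ENNReal.rpow_natCast]; norm_num
  have h3 := ENNReal.lintegral_mul_le_Lp_mul_Lq (volume.restrict (Ioi (1 : ℝ)))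
    (p := 2) (q := 2) Real.HolderConjugate.two_two hmeas
    (g := fun x => ENNReal.ofReal (x ^ ((-1 - δ) / 2)))
    (by fun_prop : Measurable _).aemeasurable
  have h4 : ∫⁻ x in Ioi (1 : ℝ), (‖F x‖ₑ * ENNReal.ofReal (x ^ (((k : ℝ) / 2 - 1 + δ) / 2))) ^ (2 : ℝ) =
      thetaMean ξ ω δ := by
    refine setLIntegral_congr_fun measurableSet_Ioi fun x hx => ?_
    have hx0 : 0 < x := zero_lt_one.trans hx
    simp only [hsq]
    rw [mul_pow, ← ENNReal.ofReal_pow (by positivity), ← Real.rpow_natCast, ← Real.rpow_mul hx0.le]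
    congr 3; push_cast; ring
  have h5 : ∫⁻ x in Ioi (1 : ℝ), (ENNReal.ofReal (x ^ ((-1 - δ) / 2))) ^ (2 : ℝ) =
      ENNReal.ofReal (1 / δ) := by
    have h6 : ∫ x in Ioi (1 : ℝ), x ^ (-1 - δ) = 1 / δ := by
      rw [integral_Ioi_rpow_of_lt (by linarith) one_pos, Real.one_rpow]
      rw [show -1 - δ + 1 = -δ by ring, neg_div_neg_eq]
    rw [← h6, ofReal_integral_eq_lintegral_ofReal (integrableOn_Ioi_rpow_of_lt (by linarith) one_pos)]
    · refine setLIntegral_congr_fun measurableSet_Ioi fun x hx => ?_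
      have hx0 : 0 < x := zero_lt_one.trans hx
      simp only [hsq]
      rw [← ENNReal.ofReal_pow (by positivity), ← Real.rpow_natCast, ← Real.rpow_mul hx0.le]
      congr 2; push_cast; ring
    · refine (ae_restrict_iff' measurableSet_Ioi).2 (ae_of_all _ fun x hx => ?_)
      have hx0 : 0 < x := zero_lt_one.trans hx
      exact Real.rpow_nonneg hx0.le _
  rw [h4, h5] at h3
  refine (pow_le_pow_left' (h1.trans h3) 2).trans (le_of_eq ?_)
  rw [mul_pow, ← hsq, ← hsq, ← ENNReal.rpow_mul, ← ENNReal.rpow_mul]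
  norm_num

/-! ### Lower bounds for the Gamma function on vertical lines. -/

theorem norm_sin_le_exp_abs_im (z : ℂ) : ‖sin z‖ ≤ Real.exp |z.im| := by
  rw [sin, norm_div, norm_mul, norm_I, mul_one]
  have h1 : ‖exp (-z * I)‖ ≤ Real.exp |z.im| := by
    rw [norm_exp]
    gcongr
    simpa using le_abs_self z.im
  have h2 : ‖exp (z * I)‖ ≤ Real.exp |z.im| := by
    rw [norm_exp]
    gcongr
    simpa using neg_le_abs z.im
  have h3 := norm_sub_le (exp (-z * I)) (exp (z * I))
  simp only [RCLike.norm_ofNat]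
  linarith

/-- On `Re s = 1/2` one has `1 - s = conj s`, so the reflection formula gives `|Γ(s)|² = π / |sin
πs|`. -/
theorem norm_Gamma_half_sq_ge {τ : ℝ} (hτ : 0 ≤ τ) :
    Real.pi * Real.exp (-(Real.pi * τ)) ≤ ‖Gamma (((1 / 2 : ℝ) : ℂ) + τ * I)‖ ^ 2 := by
  set s : ℂ := ((1 / 2 : ℝ) : ℂ) + τ * I with hs
  have h1 : 1 - s = (starRingEnd ℂ) s := by
    rw [hs]; simp only [map_add, map_mul, conj_ofReal, conj_I]; push_cast; ring
  have h := Gamma_mul_Gamma_one_sub s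
  rw [h1, Gamma_conj] at h
  have h2 : ‖Gamma s‖ ^ 2 = Real.pi / ‖sin (Real.pi * s)‖ := by
    have := congrArg norm h
    rw [norm_mul, RCLike.norm_conj, norm_div, norm_real, Real.norm_of_nonneg Real.pi_pos.le] at this
    rw [← this]; ring
  have h3 := norm_sin_le_exp_abs_im (Real.pi * s)
  have h4 : (Real.pi * s).im = Real.pi * τ := by rw [hs]; simp
  rw [h4, abs_of_nonneg (by positivity)] at h3
  rw [h2, Real.exp_neg, ← div_eq_mul_inv]
  have h5 : sin (Real.pi * s) ≠ 0 := by
    intro h0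
    rw [h0] at h2
    have : Gamma s ≠ 0 := Gamma_ne_zero_of_re_pos (by rw [hs]; simp)
    have : 0 < ‖Gamma s‖ ^ 2 := by positivity
    rw [h2] at this
    simp at this
  exact div_le_div_of_nonneg_left Real.pi_pos.le (norm_pos_iff.2 h5) h3

/-- Reflection at `iτ`, combined with `Γ(1 + iτ) = iτ Γ(iτ)` and `1 - iτ = conj (1 + iτ)`. -/
theorem norm_Gamma_one_sq_ge {τ : ℝ} (hτ : 0 < τ) :
    Real.pi * τ * Real.exp (-(Real.pi * τ)) ≤ ‖Gamma (((1 : ℝ) : ℂ) + τ * I)‖ ^ 2 := by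
  have hτ0 : (τ * I : ℂ) ≠ 0 := by simp [hτ.ne']
  set s : ℂ := ((1 : ℝ) : ℂ) + τ * I with hs
  have h1 : 1 - τ * I = (starRingEnd ℂ) s := by
    rw [hs]; simp only [map_add, map_mul, conj_ofReal, conj_I]; push_cast; ring
  have h := Gamma_mul_Gamma_one_sub (τ * I)
  have hadd : Gamma s = τ * I * Gamma (τ * I) := by
    rw [← Gamma_add_one _ hτ0, hs]; push_cast; rw [add_comm]
  rw [h1, Gamma_conj] at h
  have h2 : ‖Gamma s‖ ^ 2 = Real.pi * τ / ‖sin (Real.pi * (τ * I))‖ := by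
    have := congrArg norm h
    rw [norm_mul, RCLike.norm_conj, norm_div, norm_real, Real.norm_of_nonneg Real.pi_pos.le] at this
    rw [mul_comm Real.pi, mul_div_assoc, ← this, pow_two]
    nth_rewrite 1 [hadd]
    rw [norm_mul, norm_mul, norm_I, norm_real, Real.norm_of_nonneg hτ.le]; ring
  have h3 := norm_sin_le_exp_abs_im (Real.pi * (τ * I))
  have h4 : (Real.pi * (τ * I) : ℂ).im = Real.pi * τ := by simp
  rw [h4, abs_of_nonneg (by positivity)] at h3
  rw [h2, Real.exp_neg, ← div_eq_mul_inv]
  have h5 : sin (Real.pi * (τ * I)) ≠ 0 := by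
    intro h0
    rw [h0] at h2
    have : Gamma s ≠ 0 := Gamma_ne_zero_of_re_pos (by rw [hs]; simp)
    have : 0 < ‖Gamma s‖ ^ 2 := by positivity
    rw [h2] at this
    simp at this
  exact div_le_div_of_nonneg_left (by positivity) (norm_pos_iff.2 h5) h3

/-- With `M` the midpoint, this follows from `AB ≤ M²` and `(A² + τ²)(B² + τ²) = (AB + τ²)² + (A -
B)² τ²`. It is the inequality between single factors of Gauss's product for `Γ`. -/
theorem mul_div_norm_le_midpoint {A B : ℝ} (hA : 0 < A) (hB : 0 < B) (τ : ℝ) :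
    A / ‖(A : ℂ) + τ * I‖ * (B / ‖(B : ℂ) + τ * I‖) ≤
      (((A + B) / 2) / ‖(((A + B) / 2 : ℝ) : ℂ) + τ * I‖) ^ 2 := by
  have hn : ∀ x : ℝ, ‖(x : ℂ) + τ * I‖ = √(x ^ 2 + τ ^ 2) := fun x => norm_add_mul_I x τ
  rw [hn, hn, hn, div_mul_div_comm, ← Real.sqrt_mul (by positivity), div_pow,
    Real.sq_sqrt (by positivity), div_le_div_iff₀ (by positivity) (by positivity)]
  set M := (A + B) / 2 with hM
  have hMpos : 0 < M := by positivity
  have hAB : A * B ≤ M ^ 2 := by rw [hM]; nlinarith [sq_nonneg (A - B)]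
  rw [← div_le_iff₀' (by positivity)]
  refine Real.le_sqrt_of_sq_le ?_
  rw [div_pow, div_le_iff₀ (by positivity)]
  have hP : 0 < A * B := by positivity
  set P := A * B with hPdef
  have h1 : (A ^ 2 + τ ^ 2) * (B ^ 2 + τ ^ 2) = (P + τ ^ 2) ^ 2 + (A - B) ^ 2 * τ ^ 2 := by
    rw [hPdef]; ring
  have h2 : P * (M ^ 2 + τ ^ 2) ≤ (P + τ ^ 2) * M ^ 2 := by nlinarith [sq_nonneg τ]
  calc (P * (M ^ 2 + τ ^ 2)) ^ 2 ≤ ((P + τ ^ 2) * M ^ 2) ^ 2 := by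
        exact pow_le_pow_left₀ (by positivity) h2 2
    _ = (P + τ ^ 2) ^ 2 * (M ^ 2) ^ 2 := by ring
    _ ≤ _ := by rw [h1]; gcongr; nlinarith [mul_nonneg (sq_nonneg (A - B)) (sq_nonneg τ)]

/-- `|Γ(σ + iτ)| / Γ(σ)` is midpoint log-concave in `σ`. -/
theorem norm_Gamma_mul_le_midpoint {a b : ℝ} (ha : 0 < a) (hb : 0 < b) (τ : ℝ) :
    ‖Gamma (a + τ * I)‖ / Real.Gamma a * (‖Gamma (b + τ * I)‖ / Real.Gamma b) ≤
      (‖Gamma (((a + b) / 2 : ℝ) + τ * I)‖ / Real.Gamma ((a + b) / 2)) ^ 2 := by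
  have hlim : ∀ x : ℝ, 0 < x →
      Tendsto (fun n => ‖GammaSeq (x + τ * I) n‖ / Real.GammaSeq x n) atTop
        (𝓝 (‖Gamma (x + τ * I)‖ / Real.Gamma x)) := fun x hx =>
    (GammaSeq_tendsto_Gamma _).norm.div (Real.GammaSeq_tendsto_Gamma x) (Real.Gamma_pos_of_pos hx).ne'
  -- In Gauss's limit formula the factors `n ^ x n!` cancel from the quotient, leaving a finite
  -- product to be compared factor by factor.
  have hprod : ∀ x : ℝ, 0 < x → ∀ n : ℕ, 0 < n → ‖GammaSeq (x + τ * I) n‖ / Real.GammaSeq x n =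
      ∏ j ∈ Finset.range (n + 1), ((x + j) / ‖((x + j : ℝ) : ℂ) + τ * I‖) := by
    intro x hx n hn
    have hn' : (0 : ℝ) < n := by exact_mod_cast hn
    rw [GammaSeq, Real.GammaSeq, Finset.prod_div_distrib, norm_div, norm_mul, norm_prod,
      ← ofReal_natCast n, norm_cpow_eq_rpow_re_of_pos hn', norm_natCast]
    have h1 : ∀ j : ℕ, ((x + τ * I : ℂ) + j) = ((x + j : ℝ) : ℂ) + τ * I := fun j => by
      push_cast; ring
    simp_rw [h1]
    have h2 : (x + τ * I : ℂ).re = x := by simp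
    rw [h2]
    have h3 : (0 : ℝ) < n ^ x * n.factorial := by positivity
    rw [div_div_div_cancel_left' _ _ h3.ne']
  refine le_of_tendsto_of_tendsto ((hlim a ha).mul (hlim b hb))
    ((hlim ((a + b) / 2) (by positivity)).pow 2) ?_
  filter_upwards [eventually_gt_atTop 0] with n hn
  rw [hprod a ha n hn, hprod b hb n hn, hprod _ (by positivity) n hn, ← Finset.prod_mul_distrib,
    ← Finset.prod_pow]
  refine Finset.prod_le_prod (fun j _ => by positivity) fun j _ => ?_
  have h := mul_div_norm_le_midpoint (A := a + j) (B := b + j) (by positivity) (by positivity) τ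
  rwa [show (a + j + (b + j)) / 2 = (a + b) / 2 + j by ring] at h

/-- The lower bound for `Γ` on the line `Re s = σ` predicted by Stirling's formula. -/
def GammaLowerBound (σ : ℝ) : Prop :=
  ∃ c : ℝ, 0 < c ∧ ∀ τ : ℝ, 1 ≤ τ →
    c * τ ^ (σ - 1 / 2) * Real.exp (-(Real.pi * τ / 2)) ≤ ‖Gamma (σ + τ * I)‖

theorem gammaLowerBound_half : GammaLowerBound (1 / 2) := by
  refine ⟨1, one_pos, fun τ hτ => ?_⟩
  have h := norm_Gamma_half_sq_ge (zero_le_one.trans hτ)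
  refine le_of_sq_le_sq (le_trans ?_ h) (norm_nonneg _)
  rw [sub_self, Real.rpow_zero, one_mul, one_mul, ← Real.exp_nat_mul]
  rw [show ((2 : ℕ) : ℝ) * -(Real.pi * τ / 2) = -(Real.pi * τ) by push_cast; ring]
  exact le_mul_of_one_le_left (Real.exp_pos _).le (by linarith [Real.pi_gt_three])

theorem gammaLowerBound_one : GammaLowerBound 1 := by
  refine ⟨1, one_pos, fun τ hτ => ?_⟩
  have hτ0 : 0 < τ := by linarith
  have h := norm_Gamma_one_sq_ge hτ0
  refine le_of_sq_le_sq (le_trans ?_ h) (norm_nonneg _)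
  rw [one_mul, mul_pow, ← Real.exp_nat_mul, ← Real.rpow_natCast, ← Real.rpow_mul hτ0.le]
  rw [show ((2 : ℕ) : ℝ) * -(Real.pi * τ / 2) = -(Real.pi * τ) by push_cast; ring,
    show ((1 : ℝ) - 1 / 2) * ((2 : ℕ) : ℝ) = 1 by norm_num, Real.rpow_one]
  gcongr
  exact le_mul_of_one_le_left hτ0.le (by linarith [Real.pi_gt_three])

theorem GammaLowerBound.add_one {σ : ℝ} (h : GammaLowerBound σ) :
    GammaLowerBound (σ + 1) := by
  obtain ⟨c, hc, h⟩ := h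
  refine ⟨c, hc, fun τ hτ => ?_⟩
  have hτ0 : 0 < τ := by linarith
  have hne : (σ + τ * I : ℂ) ≠ 0 := by
    intro h0
    have := congrArg im h0
    simp at this
    linarith
  rw [show ((σ + 1 : ℝ) : ℂ) + τ * I = (σ + τ * I) + 1 by push_cast; ring, Gamma_add_one _ hne,
    norm_mul]
  have h1 : τ ≤ ‖(σ + τ * I : ℂ)‖ := by
    refine le_trans (le_of_eq ?_) (abs_im_le_norm _)
    simp [abs_of_pos hτ0]
  calc _ = τ * (c * τ ^ (σ - 1 / 2) * Real.exp (-(Real.pi * τ / 2))) := by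
        rw [show σ + 1 - 1 / 2 = (σ - 1 / 2) + 1 by ring, Real.rpow_add_one hτ0.ne']; ring
    _ ≤ _ := mul_le_mul h1 (h τ hτ) (by positivity) (norm_nonneg _)

/-- The exponent `σ - 1/2` is affine in `σ` and the exponential does not depend on `σ`, so midpoint
log-concavity preserves the shape of the bound. -/
theorem GammaLowerBound.midpoint {a b : ℝ} (ha : 0 < a) (hb : 0 < b) (hA : GammaLowerBound a)
    (hB : GammaLowerBound b) : GammaLowerBound ((a + b) / 2) := by
  obtain ⟨c, hc, hA⟩ := hA
  obtain ⟨d, hd, hB⟩ := hB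
  have hΓa := Real.Gamma_pos_of_pos ha
  have hΓb := Real.Gamma_pos_of_pos hb
  have hΓm := Real.Gamma_pos_of_pos (show 0 < (a + b) / 2 by positivity)
  set e : ℝ := √(c * d / (Real.Gamma a * Real.Gamma b)) * Real.Gamma ((a + b) / 2) with he
  refine ⟨e, by positivity, fun τ hτ => ?_⟩
  have hτ0 : 0 < τ := by linarith
  have h := norm_Gamma_mul_le_midpoint ha hb τ
  refine le_of_sq_le_sq ?_ (norm_nonneg _)
  rw [div_pow, le_div_iff₀ (by positivity)] at h
  refine le_trans ?_ h
  have h1 := mul_le_mul (hA τ hτ) (hB τ hτ) (by positivity) (norm_nonneg _)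
  have h2 : (τ ^ ((a + b) / 2 - 1 / 2)) ^ 2 = τ ^ (a - 1 / 2) * τ ^ (b - 1 / 2) := by
    rw [← Real.rpow_natCast, ← Real.rpow_mul hτ0.le, ← Real.rpow_add hτ0]; congr 1; push_cast; ring
  rw [div_mul_div_comm, mul_pow, mul_pow, h2, he, mul_pow, Real.sq_sqrt (by positivity)]
  rw [div_mul_eq_mul_div, div_mul_eq_mul_div, div_mul_eq_mul_div, div_mul_eq_mul_div]
  rw [div_le_div_iff_of_pos_right (by positivity)]
  calc _ = (c * τ ^ (a - 1 / 2) * Real.exp (-(Real.pi * τ / 2)) *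
        (d * τ ^ (b - 1 / 2) * Real.exp (-(Real.pi * τ / 2)))) * Real.Gamma ((a + b) / 2) ^ 2 := by ring
    _ ≤ _ := by gcongr

/-- The values `1/2`, `1`, `3/2` and their midpoints cover `k = 2, ..., 5`; raising `k` by `4`
shifts `σ` by `1`. -/
theorem gammaLowerBound_quarter {k : ℕ} (hk : 2 ≤ k) : GammaLowerBound ((k : ℝ) / 4) := by
  induction k using Nat.strong_induction_on with
  | _ k ih =>
    have h32 := gammaLowerBound_half.add_one
    rcases lt_or_ge k 6 with h | h
    · interval_cases k
      · convert! gammaLowerBound_half using 1; norm_num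
      · convert! gammaLowerBound_half.midpoint (by norm_num) one_pos gammaLowerBound_one using 1
        norm_num
      · convert! gammaLowerBound_one using 1; norm_num
      · convert! gammaLowerBound_one.midpoint one_pos (by norm_num) h32 using 1
        norm_num
    · have h1 := (ih (k - 4) (by omega) (by omega)).add_one
      convert! h1 using 1
      rw [Nat.cast_sub (by omega)]; push_cast; ring

/-! ### Almost orthogonality on average over the form. -/

/-- Schur's test: use `v n v m ≤ (v n ² + v m ²) / 2` and the symmetry of the kernel. -/
theorem sum_sum_mul_le_of_row_sum_le {ι : Type*} (F : Finset ι) (v : ι → ℝ) {κ : ι → ι → ℝ}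
    (hκ : ∀ n m, 0 ≤ κ n m) (hsymm : ∀ n m, κ n m = κ m n) {K : ℝ}
    (hrow : ∀ n, ∑ m ∈ F, κ n m ≤ K) :
    ∑ n ∈ F, ∑ m ∈ F, v n * v m * κ n m ≤ K * ∑ n ∈ F, v n ^ 2 := by
  have h1 : ∑ n ∈ F, ∑ m ∈ F, v n * v m * κ n m ≤
      ∑ n ∈ F, ∑ m ∈ F, (v n ^ 2 * κ n m / 2 + v m ^ 2 * κ m n / 2) := by
    refine Finset.sum_le_sum fun n _ => Finset.sum_le_sum fun m _ => ?_
    rw [hsymm m n]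
    nlinarith [mul_nonneg (sq_nonneg (v n - v m)) (hκ n m)]
  refine h1.trans ?_
  simp_rw [Finset.sum_add_distrib]
  rw [Finset.sum_comm (f := fun n m => v m ^ 2 * κ m n / 2), ← Finset.sum_add_distrib, Finset.mul_sum]
  refine Finset.sum_le_sum fun n _ => ?_
  rw [← Finset.sum_add_distrib]
  calc ∑ m ∈ F, (v n ^ 2 * κ n m / 2 + v n ^ 2 * κ n m / 2) = v n ^ 2 * ∑ m ∈ F, κ n m := by
        rw [Finset.mul_sum]; exact Finset.sum_congr rfl fun m _ => by ring
    _ ≤ v n ^ 2 * K := by gcongr; exact hrow n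
    _ = K * v n ^ 2 := mul_comm _ _

/-- The kernel measuring the correlation of the frequencies `n²` and `m²`. -/
noncomputable def squareKernel (n m : ℤ) : ℝ := 2 / (1 + |(n : ℝ) ^ 2 - (m : ℝ) ^ 2|)

theorem squareKernel_nonneg (n m : ℤ) : 0 ≤ squareKernel n m := by
  unfold squareKernel; positivity

theorem squareKernel_comm (n m : ℤ) : squareKernel n m = squareKernel m n := by
  unfold squareKernel; rw [abs_sub_comm]

theorem summable_one_div_one_add_sq : Summable fun n : ℤ => 1 / (1 + (n : ℝ) ^ 2) := by
  have h : Summable fun n : ℤ => |(n : ℝ)| ^ (-2 : ℝ) := Real.summable_abs_int_rpow (by norm_num)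
  refine Summable.of_norm_bounded_eventually (g := fun n : ℤ => |(n : ℝ)| ^ (-2 : ℝ)) h ?_
  filter_upwards [(finite_singleton (0 : ℤ)).compl_mem_cofinite] with n hn
  have hn' : 0 < |(n : ℝ)| := by simpa using hn
  rw [Real.norm_of_nonneg (by positivity), Real.rpow_neg hn'.le, ← one_div]
  have : |(n : ℝ)| ^ (2 : ℝ) = (n : ℝ) ^ 2 := by
    rw [show (2 : ℝ) = ((2 : ℕ) : ℝ) by norm_num, Real.rpow_natCast, sq_abs]
  rw [this]
  have : 0 < (n : ℝ) ^ 2 := by rw [← sq_abs]; positivity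
  gcongr
  linarith

/-- Since `|n² - m²| = |m - n| |m + n|` is at least the square of the smaller factor, the row sums
are bounded uniformly in `n`. -/
theorem squareKernel_le (n m : ℤ) :
    squareKernel n m ≤ 2 * (1 / (1 + ((m - n : ℤ) : ℝ) ^ 2)) + 2 * (1 / (1 + ((m + n : ℤ) : ℝ) ^ 2)) := by
  have h : |(n : ℝ) ^ 2 - (m : ℝ) ^ 2| = |((m - n : ℤ) : ℝ)| * |((m + n : ℤ) : ℝ)| := by
    rw [← abs_mul, abs_sub_comm]; push_cast; ring_nf
  rw [squareKernel, h, ← sq_abs ((m - n : ℤ) : ℝ), ← sq_abs ((m + n : ℤ) : ℝ)]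
  set p := |((m - n : ℤ) : ℝ)|
  set q := |((m + n : ℤ) : ℝ)|
  have hp : 0 ≤ p := abs_nonneg _
  have hq : 0 ≤ q := abs_nonneg _
  have key : ∀ a b : ℝ, 0 ≤ a → a ≤ b → 2 / (1 + a * b) ≤ 2 * (1 / (1 + a ^ 2)) := by
    intro a b ha hab
    rw [mul_one_div]
    gcongr
    nlinarith
  rcases le_total p q with hpq | hpq
  · exact (key p q hp hpq).trans (le_add_of_nonneg_right (by positivity))
  · rw [mul_comm p q]
    exact (key q p hq hpq).trans (le_add_of_nonneg_left (by positivity))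

theorem exists_squareKernel_prod_sum_le (k : ℕ) :
    ∃ K : ℝ, 0 < K ∧ ∀ (F : Finset {n : Fin k → ℤ // n ≠ 0}) (n : Fin k → ℤ),
      ∑ m ∈ F, ∏ i, squareKernel (n i) ((m : Fin k → ℤ) i) ≤ K := by
  set S : ℝ := ∑' n : ℤ, 1 / (1 + (n : ℝ) ^ 2) with hS
  have hs := summable_one_div_one_add_sq
  have hS0 : 0 ≤ S := tsum_nonneg fun n => by positivity
  have h1 : ∀ n : ℤ, Summable (squareKernel n) ∧ ∑' m, squareKernel n m ≤ 4 * S := by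
    intro n
    have ha : HasSum (fun m : ℤ => 1 / (1 + ((m - n : ℤ) : ℝ) ^ 2)) S :=
      ((Equiv.subRight n).hasSum_iff (f := fun m : ℤ => 1 / (1 + (m : ℝ) ^ 2))).2 hs.hasSum
    have hb : HasSum (fun m : ℤ => 1 / (1 + ((m + n : ℤ) : ℝ) ^ 2)) S :=
      ((Equiv.addRight n).hasSum_iff (f := fun m : ℤ => 1 / (1 + (m : ℝ) ^ 2))).2 hs.hasSum
    have hab := (ha.mul_left 2).add (hb.mul_left 2)
    have hsum : Summable (squareKernel n) :=
      hab.summable.of_nonneg_of_le (squareKernel_nonneg n) (squareKernel_le n)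
    refine ⟨hsum, (hasSum_le (squareKernel_le n) hsum.hasSum hab).trans ?_⟩
    linarith
  refine ⟨(4 * S) ^ k + 1, by positivity, fun F n => ?_⟩
  have h2 := (summable_norm_and_hasSum_pi_prod (k := k) (fun i m => squareKernel (n i) m)
    (fun i => (h1 (n i)).1.norm)).2
  have h3 : ∑ m ∈ F, ∏ i, squareKernel (n i) ((m : Fin k → ℤ) i) ≤
      ∏ i, ∑' m, squareKernel (n i) m := by
    have := sum_le_hasSum (F.map (Function.Embedding.subtype _))
      (fun m _ => Finset.prod_nonneg fun i _ => squareKernel_nonneg (n i) (m i)) h2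
    simpa only [Finset.sum_map, Function.Embedding.subtype_apply] using this
  refine h3.trans ?_
  calc ∏ i, ∑' m, squareKernel (n i) m ≤ ∏ _i : Fin k, 4 * S :=
        Finset.prod_le_prod (fun i _ => tsum_nonneg (squareKernel_nonneg _)) fun i _ => (h1 (n i)).2
    _ = (4 * S) ^ k := by simp
    _ ≤ _ := by linarith

/-- A summand of the theta series in one variable, with a weight making it integrable. -/
noncomputable def weightedTerm (z : ℂ) (n : ℤ) (u : ℝ) : ℂ :=
  exp (-((1 / 2 + Real.pi * (n : ℂ) ^ 2 * z) * u))

theorem weightedTerm_mul_conj (z : ℂ) (n m : ℤ) (u : ℝ) :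
    weightedTerm z n u * (starRingEnd ℂ) (weightedTerm z m u) =
      exp (-(1 + Real.pi * ((n : ℂ) ^ 2 * z + (m : ℂ) ^ 2 * (starRingEnd ℂ) z)) * u) := by
  rw [weightedTerm, weightedTerm, ← exp_conj, ← exp_add]
  congr 1
  simp only [map_neg, map_mul, map_add, map_div₀, map_one, map_ofNat, map_pow, conj_ofReal,
    map_intCast]
  ring

theorem integrableOn_weightedTerm {z : ℂ} (hz : 0 ≤ z.re) (n m : ℤ) (a : ℝ) :
    IntegrableOn (fun u => weightedTerm z n u * (starRingEnd ℂ) (weightedTerm z m u)) (Ioi a) := by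
  simp_rw [weightedTerm_mul_conj]
  refine integrableOn_exp_mul_complex_Ioi ?_ a
  have h1 : ∀ n : ℤ, ((n : ℂ) ^ 2) = (((n : ℝ) ^ 2 : ℝ) : ℂ) := fun n => by push_cast; rfl
  simp only [h1, neg_re, add_re, one_re, re_ofReal_mul, conj_re]
  have : 0 ≤ Real.pi * ((n : ℝ) ^ 2 * z.re + (m : ℝ) ^ 2 * z.re) := by positivity
  linarith

/-- The integral of `exp (b u)` has norm `exp (a Re b) / |b|`. The weight gives `|b| ≥ 1`, and the
oscillation gives `|b| ≥ π |Im z| |n² - m²| ≥ |n² - m²|`; adding the two explains the `2` in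
`squareKernel`. -/
theorem norm_integral_weightedTerm_le {z : ℂ} (hz : 0 ≤ z.re) (hz' : 1 / 2 ≤ |z.im|) {a : ℝ}
    (ha : 0 ≤ a) (n m : ℤ) :
    ‖∫ u in Ioi a, weightedTerm z n u * (starRingEnd ℂ) (weightedTerm z m u)‖ ≤
      Real.exp (-(Real.pi * a * z.re * (n : ℝ) ^ 2)) * Real.exp (-(Real.pi * a * z.re * (m : ℝ) ^ 2)) *
        squareKernel n m := by
  simp_rw [weightedTerm_mul_conj]
  set b : ℂ := -(1 + Real.pi * ((n : ℂ) ^ 2 * z + (m : ℂ) ^ 2 * (starRingEnd ℂ) z)) with hb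
  have h1 : ∀ n : ℤ, ((n : ℂ) ^ 2) = (((n : ℝ) ^ 2 : ℝ) : ℂ) := fun n => by push_cast; rfl
  have hre : b.re = -(1 + Real.pi * ((n : ℝ) ^ 2 * z.re + (m : ℝ) ^ 2 * z.re)) := by
    rw [hb]; simp only [h1, neg_re, add_re, one_re, re_ofReal_mul, conj_re]
  have him : b.im = -(Real.pi * (((n : ℝ) ^ 2 - (m : ℝ) ^ 2) * z.im)) := by
    rw [hb]; simp only [h1, neg_im, add_im, one_im, im_ofReal_mul, conj_im]; ring
  have hpos : 0 ≤ Real.pi * ((n : ℝ) ^ 2 * z.re + (m : ℝ) ^ 2 * z.re) := by positivity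
  rw [integral_exp_mul_complex_Ioi (by rw [hre]; linarith) a, norm_div, norm_neg, norm_exp]
  have hb1 : 1 ≤ ‖b‖ := by
    refine le_trans ?_ (abs_re_le_norm b)
    rw [hre, abs_neg, abs_of_nonneg (by linarith)]; linarith
  have hb2 : |(n : ℝ) ^ 2 - (m : ℝ) ^ 2| ≤ ‖b‖ := by
    refine le_trans ?_ (abs_im_le_norm b)
    rw [him, abs_neg, abs_mul, abs_mul, abs_of_pos Real.pi_pos]
    have := Real.pi_gt_three
    have h2 : 1 ≤ Real.pi * |z.im| := by nlinarith
    nlinarith [abs_nonneg ((n : ℝ) ^ 2 - (m : ℝ) ^ 2)]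
  have hbpos : 0 < ‖b‖ := by linarith
  have h3 : (b * a).re ≤ -(Real.pi * a * z.re * (n : ℝ) ^ 2) + -(Real.pi * a * z.re * (m : ℝ) ^ 2) := by
    rw [re_mul_ofReal, hre]; nlinarith
  rw [div_le_iff₀ hbpos, ← Real.exp_add, mul_assoc]
  refine (Real.exp_le_exp.2 h3).trans (le_mul_of_one_le_right (Real.exp_pos _).le ?_)
  rw [squareKernel, div_mul_eq_mul_div, le_div_iff₀ (by positivity)]
  linarith

theorem prod_weightedTerm {k : ℕ} (ξ : Fin k → ℝ) (z : ℂ) (n : Fin k → ℤ) :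
    ∏ i, weightedTerm z (n i) (ξ i) =
      (Real.exp (-(∑ i, ξ i) / 2) : ℂ) * exp (-(Real.pi * (diagForm ξ n : ℂ) * z)) := by
  simp_rw [weightedTerm]
  rw [← exp_sum, ofReal_exp, ← exp_add, diagForm]
  congr 1
  push_cast
  rw [Finset.mul_sum, Finset.sum_mul, ← Finset.sum_neg_distrib, ← Finset.sum_neg_distrib,
    Finset.sum_div, ← Finset.sum_add_distrib]
  exact Finset.sum_congr rfl fun i _ => by ring

/-- The box `(a, ∞)^k`. -/
def orthant (k : ℕ) (a : ℝ) : Set (Fin k → ℝ) := univ.pi fun _ => Ioi a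

theorem volume_restrict_orthant (k : ℕ) (a : ℝ) :
    (volume : Measure (Fin k → ℝ)).restrict (orthant k a) =
      Measure.pi fun _ => (volume : Measure ℝ).restrict (Ioi a) := by
  rw [volume_pi, orthant, Measure.restrict_pi_pi]

/-- Almost orthogonality of the terms of the theta series, on average over the form. -/
theorem exists_integral_norm_sum_sq_le (k : ℕ) {a : ℝ} (ha : 0 < a) {r : ℝ} (hr : (k : ℝ) / 2 < r) :
    ∃ C : ℝ, 0 < C ∧ ∀ z : ℂ, 0 < z.re → 1 / 2 ≤ |z.im| →
      ∀ F : Finset {n : Fin k → ℤ // n ≠ 0},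
        Integrable (fun ξ : Fin k → ℝ => ‖∑ n ∈ F, ∏ i, weightedTerm z ((n : Fin k → ℤ) i) (ξ i)‖ ^ 2)
          (volume.restrict (orthant k a)) ∧
        ∫ ξ in orthant k a, ‖∑ n ∈ F, ∏ i, weightedTerm z ((n : Fin k → ℤ) i) (ξ i)‖ ^ 2 ≤
          C * z.re ^ (-r) := by
  obtain ⟨K, hK, hrow⟩ := exists_squareKernel_prod_sum_le k
  have hr0 : 0 ≤ r := le_trans (by positivity) hr.le
  obtain ⟨C, hC, hexp⟩ := exp_neg_le_mul_rpow hr0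
  have hs := summable_diagForm_rpow (k := k) (ξ := fun _ => (1 : ℝ)) (fun _ => one_pos) hr
  set T : ℝ := ∑' n : {n : Fin k → ℤ // n ≠ 0}, diagForm (fun _ => 1) (n : Fin k → ℤ) ^ (-r) with hT
  have hpos : ∀ n : {n : Fin k → ℤ // n ≠ 0}, 0 < diagForm (fun _ => 1) (n : Fin k → ℤ) := fun n =>
    diagForm_pos (fun _ => one_pos) n.2
  have hT0 : 0 ≤ T := tsum_nonneg fun n => Real.rpow_nonneg (hpos n).le _
  refine ⟨K * (C * (2 * Real.pi * a) ^ (-r) * T) + 1, by positivity, fun z hz hz' F => ?_⟩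
  rw [volume_restrict_orthant]
  set μ := Measure.pi fun _ : Fin k => (volume : Measure ℝ).restrict (Ioi a) with hμ
  set g : {n : Fin k → ℤ // n ≠ 0} → (Fin k → ℝ) → ℂ :=
    fun n ξ => ∏ i, weightedTerm z ((n : Fin k → ℤ) i) (ξ i) with hg
  have hgg : ∀ n m ξ, g n ξ * (starRingEnd ℂ) (g m ξ) = ∏ i, (weightedTerm z ((n : Fin k → ℤ) i) (ξ i) *
      (starRingEnd ℂ) (weightedTerm z ((m : Fin k → ℤ) i) (ξ i))) := fun n m ξ => by
    rw [hg, map_prod, Finset.prod_mul_distrib]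
  have hint : ∀ n m, Integrable (fun ξ => g n ξ * (starRingEnd ℂ) (g m ξ)) μ := fun n m => by
    simp_rw [hgg]
    exact Integrable.fintype_prod (f := fun i u => weightedTerm z ((n : Fin k → ℤ) i) u *
      (starRingEnd ℂ) (weightedTerm z ((m : Fin k → ℤ) i) u))
      fun i => integrableOn_weightedTerm hz.le _ _ a
  -- The square is opened into pairs `(n, m)`, whose integrals factor over the coordinates.
  have hsq : ∀ ξ, ((‖∑ n ∈ F, g n ξ‖ ^ 2 : ℝ) : ℂ) =
      ∑ n ∈ F, ∑ m ∈ F, g n ξ * (starRingEnd ℂ) (g m ξ) := fun ξ => by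
    rw [← Finset.sum_mul_sum, ← map_sum, mul_conj, normSq_eq_norm_sq]
  have hI : Integrable (fun ξ => ((‖∑ n ∈ F, g n ξ‖ ^ 2 : ℝ) : ℂ)) μ := by
    simp_rw [hsq]
    exact integrable_finsetSum _ fun n _ => integrable_finsetSum _ fun m _ => hint n m
  have hIre : Integrable (fun ξ => ‖∑ n ∈ F, g n ξ‖ ^ 2) μ := by
    exact hI.re.congr (ae_of_all _ fun ξ => ofReal_re _)
  refine ⟨hIre, ?_⟩
  set v : {n : Fin k → ℤ // n ≠ 0} → ℝ :=
    fun n => Real.exp (-(Real.pi * a * z.re * diagForm (fun _ => 1) (n : Fin k → ℤ))) with hv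
  have hvprod : ∀ n, v n = ∏ i, Real.exp (-(Real.pi * a * z.re * ((n : Fin k → ℤ) i : ℝ) ^ 2)) := by
    intro n
    simp only [hv]
    rw [← Real.exp_sum, diagForm, Finset.mul_sum, ← Finset.sum_neg_distrib]
    simp
  have hpair : ∀ n m, ‖∫ ξ, g n ξ * (starRingEnd ℂ) (g m ξ) ∂μ‖ ≤
      v n * v m * ∏ i, squareKernel ((n : Fin k → ℤ) i) ((m : Fin k → ℤ) i) := fun n m => by
    simp_rw [hgg]
    rw [hμ, integral_fintype_prod_eq_prod (𝕜 := ℂ) (fun i u => weightedTerm z ((n : Fin k → ℤ) i) u *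
      (starRingEnd ℂ) (weightedTerm z ((m : Fin k → ℤ) i) u)), norm_prod, hvprod, hvprod,
      ← Finset.prod_mul_distrib, ← Finset.prod_mul_distrib]
    exact Finset.prod_le_prod (fun i _ => norm_nonneg _) fun i _ =>
      norm_integral_weightedTerm_le hz.le hz' ha.le _ _
  have h1 : ∫ ξ, ‖∑ n ∈ F, g n ξ‖ ^ 2 ∂μ ≤
      ∑ n ∈ F, ∑ m ∈ F, v n * v m * ∏ i, squareKernel ((n : Fin k → ℤ) i) ((m : Fin k → ℤ) i) := by
    have h2 : ((∫ ξ, ‖∑ n ∈ F, g n ξ‖ ^ 2 ∂μ : ℝ) : ℂ) =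
        ∑ n ∈ F, ∑ m ∈ F, ∫ ξ, g n ξ * (starRingEnd ℂ) (g m ξ) ∂μ := by
      rw [← integral_complex_ofReal]
      simp_rw [hsq]
      rw [integral_finsetSum _ fun n _ => integrable_finsetSum _ fun m _ => hint n m]
      exact Finset.sum_congr rfl fun n _ => integral_finsetSum _ fun m _ => hint n m
    refine (Real.le_norm_self _).trans ?_
    rw [← norm_real, h2]
    refine (norm_sum_le _ _).trans (Finset.sum_le_sum fun n _ => ?_)
    exact (norm_sum_le _ _).trans (Finset.sum_le_sum fun m _ => hpair n m)
  have h3 := sum_sum_mul_le_of_row_sum_le F v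
    (κ := fun n m => ∏ i, squareKernel ((n : Fin k → ℤ) i) ((m : Fin k → ℤ) i))
    (fun n m => Finset.prod_nonneg fun i _ => squareKernel_nonneg _ _)
    (fun n m => Finset.prod_congr rfl fun i _ => squareKernel_comm _ _) (fun n => hrow F n)
  -- After Schur's test only the diagonal is left, a theta series of the standard form at `2 a Re
  -- z`. Here `a > 0` is essential.
  have h4 : ∑ n ∈ F, v n ^ 2 ≤ C * (2 * Real.pi * a) ^ (-r) * T * z.re ^ (-r) := by
    calc ∑ n ∈ F, v n ^ 2 ≤ ∑ n ∈ F, C * (2 * Real.pi * a) ^ (-r) * z.re ^ (-r) *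
          diagForm (fun _ => 1) (n : Fin k → ℤ) ^ (-r) := by
          refine Finset.sum_le_sum fun n _ => ?_
          have hn := hpos n
          have h5 : v n ^ 2 =
              Real.exp (-((2 * Real.pi * a) * z.re * diagForm (fun _ => 1) (n : Fin k → ℤ))) := by
            simp only [hv]
            rw [← Real.exp_nat_mul]; congr 1; push_cast; ring
          rw [h5]
          refine (hexp _ (by positivity)).trans (le_of_eq ?_)
          rw [Real.mul_rpow (by positivity) hn.le, Real.mul_rpow (by positivity) hz.le]
          ring
      _ ≤ C * (2 * Real.pi * a) ^ (-r) * z.re ^ (-r) * T := by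
          rw [← Finset.mul_sum]
          gcongr
          exact hs.sum_le_tsum _ fun n _ => Real.rpow_nonneg (hpos n).le _
      _ = _ := by ring
  refine h1.trans (h3.trans ?_)
  have h6 : 0 ≤ z.re ^ (-r) := Real.rpow_nonneg hz.le _
  calc K * ∑ n ∈ F, v n ^ 2 ≤ K * (C * (2 * Real.pi * a) ^ (-r) * T * z.re ^ (-r)) := by gcongr
    _ ≤ _ := by nlinarith

theorem measurableSet_orthant (k : ℕ) (a : ℝ) : MeasurableSet (orthant k a) :=
  MeasurableSet.univ_pi fun _ => measurableSet_Ioi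

theorem pos_of_mem_orthant {k : ℕ} {a : ℝ} (ha : 0 ≤ a) {ξ : Fin k → ℝ} (hξ : ξ ∈ orthant k a)
    (i : Fin k) : 0 < ξ i := lt_of_le_of_lt ha (hξ i (mem_univ i))

/-- The bound for finite partial sums is uniform in the set of vectors, so Fatou's lemma carries it
to the full series. -/
theorem exists_lintegral_diagTheta_sq_le (k : ℕ) {a : ℝ} (ha : 0 < a) {r : ℝ}
    (hr : (k : ℝ) / 2 < r) :
    ∃ C : ℝ, 0 < C ∧ ∀ z : ℂ, 0 < z.re → 1 / 2 ≤ |z.im| →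
      ∫⁻ ξ in orthant k a, ‖diagTheta ξ z - 1‖ₑ ^ 2 * ENNReal.ofReal (Real.exp (-∑ i, ξ i)) ≤
        ENNReal.ofReal (C * z.re ^ (-r)) := by
  obtain ⟨C, hC, h⟩ := exists_integral_norm_sum_sq_le k ha hr
  refine ⟨C, hC, fun z hz hz' => ?_⟩
  set S : Finset {n : Fin k → ℤ // n ≠ 0} → (Fin k → ℝ) → ℂ :=
    fun F ξ => ∑ n ∈ F, ∏ i, weightedTerm z ((n : Fin k → ℤ) i) (ξ i) with hS
  have hlim : ∀ ξ ∈ orthant k a, liminf (fun F => ‖S F ξ‖ₑ ^ 2) atTop =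
      ‖diagTheta ξ z - 1‖ₑ ^ 2 * ENNReal.ofReal (Real.exp (-∑ i, ξ i)) := by
    intro ξ hξ
    have hsum := (hasSum_diagTheta_sub_one (pos_of_mem_orthant ha.le hξ) hz).mul_left
      (Real.exp (-(∑ i, ξ i) / 2) : ℂ)
    simp_rw [← prod_weightedTerm] at hsum
    have h2 : Tendsto (fun F => S F ξ) atTop
        (𝓝 ((Real.exp (-(∑ i, ξ i) / 2) : ℂ) * (diagTheta ξ z - 1))) := hsum
    have h3 := ((ENNReal.continuous_pow 2).tendsto _).comp h2.enorm
    have h4 := h3.liminf_eq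
    rw [enorm_mul, mul_pow, ← ofReal_norm (Real.exp (-(∑ i, ξ i) / 2) : ℂ), norm_real,
      Real.norm_of_nonneg (Real.exp_pos _).le, ← ENNReal.ofReal_pow (Real.exp_pos _).le,
      ← Real.exp_nat_mul, mul_comm] at h4
    rw [show -∑ i, ξ i = ((2 : ℕ) : ℝ) * (-(∑ i, ξ i) / 2) by push_cast; ring]
    exact h4
  rw [← setLIntegral_congr_fun (measurableSet_orthant k a) hlim]
  have hmeas : ∀ F, Measurable fun ξ => ‖S F ξ‖ₑ ^ 2 := by
    intro F
    have : Continuous (S F) := by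
      simp only [hS, weightedTerm]
      fun_prop
    exact (this.measurable.enorm).pow_const 2
  refine (lintegral_liminf_le hmeas).trans ?_
  refine liminf_le_of_le (by isBoundedDefault) fun b hb => ?_
  obtain ⟨F, hF⟩ := hb.exists
  refine hF.trans ?_
  obtain ⟨h1, h2⟩ := h z hz hz' F
  refine le_trans (le_of_eq ?_) (ENNReal.ofReal_le_ofReal h2)
  rw [ofReal_integral_eq_lintegral_ofReal h1 (ae_of_all _ fun ξ => by positivity)]
  refine lintegral_congr fun ξ => ?_
  rw [ENNReal.ofReal_pow (norm_nonneg _), ofReal_norm]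

theorem aemeasurable_thetaMean_integrand (k : ℕ) {a : ℝ} (ha : 0 < a) {ω : ℂ} (hω : 0 < ω.re)
    (δ : ℝ) :
    AEMeasurable (fun p : (Fin k → ℝ) × ℝ => ‖diagTheta p.1 (p.2 * ω) - 1‖ₑ ^ 2 *
      ENNReal.ofReal (p.2 ^ ((k : ℝ) / 2 - 1 + δ)))
      ((volume.restrict (orthant k a)).prod (volume.restrict (Ioi 1))) := by
  rw [Measure.prod_restrict]
  have hc : ContinuousOn (fun p : (Fin k → ℝ) × ℝ => diagTheta p.1 (p.2 * ω) - 1)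
      (orthant k a ×ˢ Ioi 1) := by
    refine ContinuousOn.sub ?_ continuousOn_const
    refine (continuousOn_diagTheta (k := k)).comp
      (f := fun p : (Fin k → ℝ) × ℝ => (p.1, (p.2 : ℂ) * ω)) (by fun_prop) fun p hp => ?_
    refine ⟨pos_of_mem_orthant ha.le hp.1, ?_⟩
    simp only [re_ofReal_mul]
    exact mul_pos (zero_lt_one.trans hp.2) hω
  have h1 := (hc.aemeasurable ((measurableSet_orthant k a).prod measurableSet_Ioi)
    (μ := volume.prod volume)).enorm.pow_const 2
  have h2 : Measurable fun p : (Fin k → ℝ) × ℝ =>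
      ENNReal.ofReal (p.2 ^ ((k : ℝ) / 2 - 1 + δ)) := by fun_prop
  exact h1.mul h2.aemeasurable

theorem aemeasurable_thetaMean (k : ℕ) {a : ℝ} (ha : 0 < a) {ω : ℂ} (hω : 0 < ω.re) (δ : ℝ) :
    AEMeasurable (fun ξ : Fin k → ℝ => thetaMean ξ ω δ) (volume.restrict (orthant k a)) :=
  (aemeasurable_thetaMean_integrand k ha hω δ).lintegral_prod_right'

/-- Tonelli, then the average at `z = x ω` with `x > 1`. The choice `r = k/2 + 2δ` leaves `x ^ (-1 -
δ)`, which is integrable. -/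
theorem exists_lintegral_thetaMean_le (k : ℕ) {a : ℝ} (ha : 0 < a) {δ : ℝ} (hδ : 0 < δ) :
    ∃ C : ℝ, 0 < C ∧ ∀ ω : ℂ, 0 < ω.re → 1 / 2 ≤ |ω.im| →
      ∫⁻ ξ in orthant k a, thetaMean ξ ω δ * ENNReal.ofReal (Real.exp (-∑ i, ξ i)) ≤
        ENNReal.ofReal (C * ω.re ^ (-((k : ℝ) / 2 + 2 * δ))) := by
  obtain ⟨C, hC, h⟩ := exists_lintegral_diagTheta_sq_le k ha
    (r := (k : ℝ) / 2 + 2 * δ) (by linarith)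
  refine ⟨C * (1 / δ), by positivity, fun ω hω hω' => ?_⟩
  set r := (k : ℝ) / 2 + 2 * δ with hr
  have hW : Measurable fun ξ : Fin k → ℝ => ENNReal.ofReal (Real.exp (-∑ i, ξ i)) := by fun_prop
  have hmeas := (aemeasurable_thetaMean_integrand k ha hω δ).mul
    (hW.comp measurable_fst).aemeasurable
  calc ∫⁻ ξ in orthant k a, thetaMean ξ ω δ * ENNReal.ofReal (Real.exp (-∑ i, ξ i))
      = ∫⁻ ξ in orthant k a, ∫⁻ x in Ioi (1 : ℝ), ‖diagTheta ξ (x * ω) - 1‖ₑ ^ 2 *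
          ENNReal.ofReal (x ^ ((k : ℝ) / 2 - 1 + δ)) * ENNReal.ofReal (Real.exp (-∑ i, ξ i)) := by
        refine lintegral_congr fun ξ => ?_
        rw [thetaMean, lintegral_mul_const' _ _ ENNReal.ofReal_ne_top]
    _ = ∫⁻ x in Ioi (1 : ℝ), ∫⁻ ξ in orthant k a, ‖diagTheta ξ (x * ω) - 1‖ₑ ^ 2 *
          ENNReal.ofReal (x ^ ((k : ℝ) / 2 - 1 + δ)) * ENNReal.ofReal (Real.exp (-∑ i, ξ i)) :=
        lintegral_lintegral_swap (hmeas.congr (ae_of_all _ fun p => rfl))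
    _ ≤ ∫⁻ x in Ioi (1 : ℝ), ENNReal.ofReal (C * ω.re ^ (-r) * x ^ (-1 - δ)) := by
        refine setLIntegral_mono' measurableSet_Ioi fun x hx => ?_
        have hx1 : 1 < x := hx
        have hx0 : 0 < x := zero_lt_one.trans hx
        have h1 := h (x * ω) (by rw [re_ofReal_mul]; positivity)
          (by rw [im_ofReal_mul, abs_mul, abs_of_pos hx0]; nlinarith [abs_nonneg ω.im])
        have h2 : ∀ ξ : Fin k → ℝ, ‖diagTheta ξ (x * ω) - 1‖ₑ ^ 2 *
            ENNReal.ofReal (x ^ ((k : ℝ) / 2 - 1 + δ)) * ENNReal.ofReal (Real.exp (-∑ i, ξ i)) =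
            ‖diagTheta ξ (x * ω) - 1‖ₑ ^ 2 * ENNReal.ofReal (Real.exp (-∑ i, ξ i)) *
            ENNReal.ofReal (x ^ ((k : ℝ) / 2 - 1 + δ)) := fun ξ => mul_right_comm _ _ _
        rw [lintegral_congr h2]
        rw [lintegral_mul_const' _ _ ENNReal.ofReal_ne_top]
        refine (mul_le_mul_left h1 _).trans (le_of_eq ?_)
        rw [← ENNReal.ofReal_mul (by rw [re_ofReal_mul]; positivity), re_ofReal_mul,
          Real.mul_rpow hx0.le hω.le]
        congr 1
        rw [show -1 - δ = -r + ((k : ℝ) / 2 - 1 + δ) by rw [hr]; ring, Real.rpow_add hx0 (-r)]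
        ring
    _ = ENNReal.ofReal (C * (1 / δ) * ω.re ^ (-r)) := by
        have h6 : ∫ x in Ioi (1 : ℝ), x ^ (-1 - δ) = 1 / δ := by
          rw [integral_Ioi_rpow_of_lt (by linarith) one_pos, Real.one_rpow]
          rw [show -1 - δ + 1 = -δ by ring, neg_div_neg_eq]
        rw [← ofReal_integral_eq_lintegral_ofReal, integral_const_mul, h6]
        · congr 1; ring
        · exact (integrableOn_Ioi_rpow_of_lt (by linarith) one_pos).const_mul _
        · refine (ae_restrict_iff' measurableSet_Ioi).2 (ae_of_all _ fun x hx => ?_)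
          have hx0 : 0 < x := zero_lt_one.trans hx
          exact mul_nonneg (mul_nonneg hC.le (Real.rpow_nonneg hω.le _)) (Real.rpow_nonneg hx0.le _)

/-! ### Dyadic rays and the exceptional null set. -/

/-- The rotation by the angle `π / 2 - 2 ^ (-j)`. -/
noncomputable def rayDirection (j : ℕ) : ℂ := exp (((Real.pi / 2 - (2 ^ j)⁻¹ : ℝ) : ℂ) * I)

theorem rayDirection_re (j : ℕ) : (2 ^ j : ℝ)⁻¹ / 2 ≤ (rayDirection j).re := by
  have h0 : (0 : ℝ) < (2 ^ j)⁻¹ := by positivity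
  have h1 : ((2 : ℝ) ^ j)⁻¹ ≤ 1 := inv_le_one_of_one_le₀ (one_le_pow₀ (by norm_num))
  rw [rayDirection, exp_ofReal_mul_I_re, Real.cos_pi_div_two_sub]
  have h2 := Real.mul_le_sin h0.le (by linarith [Real.pi_gt_three])
  refine le_trans ?_ h2
  rw [div_eq_mul_inv, mul_comm]
  gcongr
  rw [← one_div, div_le_div_iff₀ (by norm_num) Real.pi_pos]
  linarith [Real.pi_le_four]

theorem rayDirection_re_pos (j : ℕ) : 0 < (rayDirection j).re :=
  lt_of_lt_of_le (by positivity) (rayDirection_re j)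

theorem rayDirection_im (j : ℕ) : 1 / 2 ≤ |(rayDirection j).im| := by
  have h0 : (0 : ℝ) < (2 ^ j)⁻¹ := by positivity
  have h1 : ((2 : ℝ) ^ j)⁻¹ ≤ 1 := inv_le_one_of_one_le₀ (one_le_pow₀ (by norm_num))
  rw [rayDirection, exp_ofReal_mul_I_im, Real.sin_pi_div_two_sub]
  refine le_trans ?_ (le_abs_self _)
  have := Real.one_sub_sq_div_two_le_cos (x := ((2 : ℝ) ^ j)⁻¹)
  nlinarith

theorem norm_rayDirection (j : ℕ) : ‖rayDirection j‖ = 1 := norm_exp_ofReal_mul_I _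

theorem arg_rayDirection (j : ℕ) : arg (rayDirection j) = Real.pi / 2 - (2 ^ j)⁻¹ := by
  have h0 : (0 : ℝ) < (2 ^ j)⁻¹ := by positivity
  have h1 : ((2 : ℝ) ^ j)⁻¹ ≤ 1 := inv_le_one_of_one_le₀ (one_le_pow₀ (by norm_num))
  rw [rayDirection, arg_exp_mul_I, toIocMod_eq_self]
  constructor <;> linarith [Real.pi_gt_three]

/-- The theta series of the form has the expected size on the rays approaching the imaginary
axis. -/
def ThetaMeanBounded {k : ℕ} (ξ : Fin k → ℝ) : Prop :=
  ∀ m : ℕ, ∃ C : ℝ, ∀ j : ℕ, thetaMean ξ (rayDirection j) (1 / ((m : ℝ) + 1)) ≤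
    ENNReal.ofReal (C * ((2 : ℝ) ^ j) ^ ((k : ℝ) / 2 + 3 * (1 / ((m : ℝ) + 1))))

/-- With `T = 2 ^ j`, the weighted average is `≪ T ^ (k/2 + 2δ)`. Divided by `T ^ (k/2 + 3δ)` it is
summable over `j`, so the sum of the normalised means is finite almost everywhere and bounds each of
its terms. -/
theorem ae_thetaMean_le (k : ℕ) {a : ℝ} (ha : 0 < a) {δ : ℝ} (hδ : 0 < δ) :
    ∀ᵐ ξ ∂(volume.restrict (orthant k a)), ∃ C : ℝ, ∀ j : ℕ, thetaMean ξ (rayDirection j) δ ≤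
      ENNReal.ofReal (C * ((2 : ℝ) ^ j) ^ ((k : ℝ) / 2 + 3 * δ)) := by
  obtain ⟨C, hC, h⟩ := exists_lintegral_thetaMean_le k ha hδ
  set r := (k : ℝ) / 2 + 2 * δ with hr
  set q := (k : ℝ) / 2 + 3 * δ with hq
  have hr0 : 0 < r := by positivity
  set G : ℕ → (Fin k → ℝ) → ENNReal := fun j ξ => ENNReal.ofReal (((2 : ℝ) ^ j) ^ (-q)) *
    (thetaMean ξ (rayDirection j) δ * ENNReal.ofReal (Real.exp (-∑ i, ξ i))) with hG
  have hW : Measurable fun ξ : Fin k → ℝ => ENNReal.ofReal (Real.exp (-∑ i, ξ i)) := by fun_prop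
  have hGm : ∀ j, AEMeasurable (G j) (volume.restrict (orthant k a)) := fun j =>
    ((aemeasurable_thetaMean k ha (rayDirection_re_pos j) δ).mul hW.aemeasurable).const_mul _
  have hGj : ∀ j, ∫⁻ ξ in orthant k a, G j ξ ≤
      ENNReal.ofReal (C * 2 ^ r * ((2 : ℝ) ^ (-δ)) ^ j) := by
    intro j
    rw [lintegral_const_mul' _ _ ENNReal.ofReal_ne_top]
    refine (mul_le_mul_right (h _ (rayDirection_re_pos j) (rayDirection_im j)) _).trans ?_
    rw [← ENNReal.ofReal_mul (by positivity)]
    refine ENNReal.ofReal_le_ofReal ?_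
    have h1 : (rayDirection j).re ^ (-r) ≤ ((2 ^ j : ℝ)⁻¹ / 2) ^ (-r) :=
      Real.rpow_le_rpow_of_nonpos (by positivity) (rayDirection_re j) (by linarith)
    have h2 : ((2 ^ j : ℝ)⁻¹ / 2) ^ (-r) = (2 ^ j : ℝ) ^ r * 2 ^ r := by
      rw [show (2 ^ j : ℝ)⁻¹ / 2 = (2 ^ j * 2)⁻¹ by rw [mul_inv]; rfl,
        Real.inv_rpow (by positivity), Real.rpow_neg (by positivity), inv_inv,
        Real.mul_rpow (by positivity) (by positivity)]
    have h3 : ((2 : ℝ) ^ (-δ)) ^ j = ((2 : ℝ) ^ j) ^ (-q) * (2 ^ j : ℝ) ^ r := by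
      rw [← Real.rpow_add (by positivity), ← Real.rpow_natCast, ← Real.rpow_mul (by norm_num),
        ← Real.rpow_natCast, ← Real.rpow_mul (by norm_num)]
      congr 1
      rw [hq, hr]; ring
    calc ((2 : ℝ) ^ j) ^ (-q) * (C * (rayDirection j).re ^ (-r))
        ≤ ((2 : ℝ) ^ j) ^ (-q) * (C * ((2 ^ j : ℝ) ^ r * 2 ^ r)) := by rw [← h2]; gcongr
      _ = _ := by rw [h3]; ring
  have hfin : ∫⁻ ξ in orthant k a, ∑' j, G j ξ ≠ ⊤ := by
    rw [lintegral_tsum hGm]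
    have hq1 : (2 : ℝ) ^ (-δ) < 1 := Real.rpow_lt_one_of_one_lt_of_neg (by norm_num) (by linarith)
    have hs : Summable fun j : ℕ => C * 2 ^ r * ((2 : ℝ) ^ (-δ)) ^ j :=
      (summable_geometric_of_lt_one (by positivity) hq1).mul_left _
    refine ne_top_of_le_ne_top ?_ (ENNReal.tsum_le_tsum hGj)
    rw [← ENNReal.ofReal_tsum_of_nonneg (fun j => by positivity) hs]
    exact ENNReal.ofReal_ne_top
  filter_upwards [ae_lt_top' (AEMeasurable.tsum hGm) hfin] with ξ hξ
  set B := (∑' j, G j ξ).toReal with hB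
  have hBe : ENNReal.ofReal B = ∑' j, G j ξ := ENNReal.ofReal_toReal hξ.ne
  refine ⟨B * Real.exp (∑ i, ξ i), fun j => ?_⟩
  have h1 : G j ξ ≤ ENNReal.ofReal B := by rw [hBe]; exact ENNReal.le_tsum j
  have h2 : thetaMean ξ (rayDirection j) δ =
      G j ξ * (ENNReal.ofReal (((2 : ℝ) ^ j) ^ q) * ENNReal.ofReal (Real.exp (∑ i, ξ i))) := by
    simp only [hG]
    have e1 : ENNReal.ofReal (((2 : ℝ) ^ j) ^ (-q)) * ENNReal.ofReal (((2 : ℝ) ^ j) ^ q) = 1 := by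
      rw [← ENNReal.ofReal_mul (by positivity), ← Real.rpow_add (by positivity), neg_add_cancel,
        Real.rpow_zero, ENNReal.ofReal_one]
    have e2 : ENNReal.ofReal (Real.exp (-∑ i, ξ i)) * ENNReal.ofReal (Real.exp (∑ i, ξ i)) = 1 := by
      rw [← ENNReal.ofReal_mul (Real.exp_pos _).le, ← Real.exp_add, neg_add_cancel, Real.exp_zero,
        ENNReal.ofReal_one]
    calc thetaMean ξ (rayDirection j) δ
        = thetaMean ξ (rayDirection j) δ *
          (ENNReal.ofReal (((2 : ℝ) ^ j) ^ (-q)) * ENNReal.ofReal (((2 : ℝ) ^ j) ^ q)) *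
          (ENNReal.ofReal (Real.exp (-∑ i, ξ i)) * ENNReal.ofReal (Real.exp (∑ i, ξ i))) := by
          rw [e1, e2, mul_one, mul_one]
      _ = _ := by ring
  rw [h2]
  refine (mul_le_mul_left h1 _).trans (le_of_eq ?_)
  rw [← ENNReal.ofReal_mul (by positivity), ← ENNReal.ofReal_mul ENNReal.toReal_nonneg]
  congr 1; ring

/-- The positive orthant is a countable union of boxes bounded away from `0`, where the averages
apply. -/
theorem ae_thetaMeanBounded (k : ℕ) :
    volume {ξ : Fin k → ℝ | (∀ i, 0 < ξ i) ∧ ¬ ThetaMeanBounded ξ} = 0 := by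
  have h : ∀ n : ℕ, volume (orthant k (1 / ((n : ℝ) + 1)) ∩ {ξ | ¬ ThetaMeanBounded ξ}) = 0 := by
    intro n
    -- Only the countably many `δ = 1 / (m + 1)` occur, so the exceptional sets can be united.
    have h1 : ∀ᵐ ξ ∂(volume.restrict (orthant k (1 / ((n : ℝ) + 1)))), ThetaMeanBounded ξ :=
      ae_all_iff.2 fun m => ae_thetaMean_le k (by positivity) (by positivity)
    rw [ae_iff, Measure.restrict_apply' (measurableSet_orthant k _)] at h1
    rwa [inter_comm]
  refine measure_mono_null (fun ξ hξ => ?_) (measure_iUnion_null h)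
  obtain ⟨hpos, hbad⟩ := hξ
  have h2 : ∀ i, ∃ n : ℕ, 1 / ((n : ℝ) + 1) < ξ i := fun i => exists_nat_one_div_lt (hpos i)
  choose N hN using h2
  refine mem_iUnion.2 ⟨∑ i, N i, fun i _ => ?_, hbad⟩
  refine lt_of_le_of_lt ?_ (hN i)
  have h3 : N i ≤ ∑ i, N i := Finset.single_le_sum (fun j _ => Nat.zero_le _) (Finset.mem_univ i)
  have h4 : (N i : ℝ) ≤ ((∑ i, N i : ℕ) : ℝ) := by exact_mod_cast h3
  gcongr

/-- The dual form has diagonal `ξ⁻¹`, and inversion, being differentiable on positive vectors,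
preserves null sets. -/
theorem ae_thetaMeanBounded_inv (k : ℕ) :
    volume {ξ : Fin k → ℝ | (∀ i, 0 < ξ i) ∧ ¬ ThetaMeanBounded ξ⁻¹} = 0 := by
  have hd : DifferentiableOn ℝ (fun ξ : Fin k → ℝ => ξ⁻¹)
      {ξ : Fin k → ℝ | (∀ i, 0 < ξ i) ∧ ¬ ThetaMeanBounded ξ} := by
    refine differentiableOn_pi.2 fun i => ?_
    exact DifferentiableOn.inv (by fun_prop) fun ξ hξ => (hξ.1 i).ne'
  have h := addHaar_image_eq_zero_of_differentiableOn_of_addHaar_eq_zero volume hd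
    (ae_thetaMeanBounded k)
  refine measure_mono_null (fun ξ hξ => ?_) h
  exact ⟨ξ⁻¹, ⟨fun i => inv_pos.2 (hξ.1 i), hξ.2⟩, inv_inv ξ⟩

/-! ### Conjugation symmetry and the dyadic bounds. -/

theorem diagTheta_conj {k : ℕ} {ξ : Fin k → ℝ} (hξ : ∀ i, 0 < ξ i) {z : ℂ} (hz : 0 < z.re) :
    diagTheta ξ ((starRingEnd ℂ) z) = (starRingEnd ℂ) (diagTheta ξ z) := by
  have h1 := hasSum_diagTheta hξ hz
  have h2 := hasSum_diagTheta hξ (z := (starRingEnd ℂ) z) (by simpa using hz)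
  have h3 := (hasSum_conj'.2 h1)
  refine h2.unique ?_
  refine h3.congr_fun fun n => ?_
  rw [← exp_conj]
  simp

/-- For `|ω| = 1` the inverse ray is the conjugate ray, and the theta series has real coefficients.
-/
theorem thetaMean_inv {k : ℕ} {ξ : Fin k → ℝ} (hξ : ∀ i, 0 < ξ i) {ω : ℂ} (hω : 0 < ω.re)
    (hω1 : ‖ω‖ = 1) (δ : ℝ) : thetaMean ξ ω⁻¹ δ = thetaMean ξ ω δ := by
  refine setLIntegral_congr_fun measurableSet_Ioi fun x hx => ?_
  have hx0 : 0 < x := zero_lt_one.trans hx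
  have h1 : (x : ℂ) * ω⁻¹ = (starRingEnd ℂ) (x * ω) := by
    rw [RCLike.inv_eq_conj hω1, map_mul, conj_ofReal]
  have h2 : diagTheta ξ (x * ω⁻¹) - 1 = (starRingEnd ℂ) (diagTheta ξ (x * ω) - 1) := by
    rw [h1, diagTheta_conj hξ (by rw [re_ofReal_mul]; positivity), map_sub, map_one]
  rw [h2, ← ofReal_norm, RCLike.norm_conj, ofReal_norm]

/-- The function `s ↦ conj (E (conj s))` continues the same Dirichlet series. This reduces negative
`t` to positive `t`. -/
theorem epsteinZeta_conj {k : ℕ} (hk : 0 < k) {ξ : Fin k → ℝ} (hξ : ∀ i, 0 < ξ i) {s : ℂ}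
    (hs : s ≠ 1) :
    epsteinZeta (Matrix.diagonal ξ) ((starRingEnd ℂ) s) =
      (starRingEnd ℂ) (epsteinZeta (Matrix.diagonal ξ) s) := by
  have hE := isEpsteinContinuation_epsteinZeta hk hξ
  set E := epsteinZeta (Matrix.diagonal ξ)
  have hG : IsEpsteinContinuation (Matrix.diagonal ξ)
      (fun s => (starRingEnd ℂ) (E ((starRingEnd ℂ) s))) := by
    constructor
    · intro s hs
      have hs' : (starRingEnd ℂ) s ≠ 1 := fun h => hs (by
        have := congrArg (starRingEnd ℂ) h
        simpa using this)
      have hd : DifferentiableAt ℂ E ((starRingEnd ℂ) s) :=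
        hE.1.differentiableAt (isOpen_compl_singleton.mem_nhds hs')
      have := hd.conj_conj
      rw [conj_conj] at this
      exact this.differentiableWithinAt
    · intro s hs
      have h := hasSum_conj'.2 (hE.2 ((starRingEnd ℂ) s) (by simpa using hs))
      refine h.congr_fun fun n => ?_
      rw [quadFormAt_diagonal]
      have hn := diagForm_pos hξ n.2
      have h1 := cpow_conj (diagForm ξ n : ℂ) (-((k : ℂ) * (starRingEnd ℂ) s / 2))
        (by rw [arg_ofReal_of_nonneg hn.le]; exact Real.pi_pos.ne)
      rw [conj_ofReal] at h1
      rw [← h1]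
      congr 1
      simp [conj_ofNat]
  have hs' : (starRingEnd ℂ) s ≠ 1 := fun h => hs (by
    have := congrArg (starRingEnd ℂ) h
    simpa using this)
  have := hE.eqOn hG hs'
  simpa using this

/-- On a dyadic interval the Epstein zeta-function is controlled by the theta integrals on one
ray. -/
theorem exists_norm_epsteinZeta_le_dyadic {k : ℕ} (hk : 2 ≤ k) {ξ : Fin k → ℝ}
    (hξ : ∀ i, 0 < ξ i) :
    ∃ C : ℝ, 0 < C ∧ ∀ (j : ℕ) (t : ℝ), (2 : ℝ) ^ j ≤ t → t ≤ 2 ^ (j + 1) →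
      ‖epsteinZeta (Matrix.diagonal ξ) (1 / 2 + t * I)‖ ≤
        C * ((2 : ℝ) ^ j) ^ (1 / 2 - (k : ℝ) / 4) *
        (‖mellin (thetaTail ξ (rayDirection j)) (((k : ℝ) / 4 : ℝ) + (k * t / 2 : ℝ) * I)‖ +
          ‖mellin (thetaTail ξ⁻¹ (rayDirection j)⁻¹)
            (((k : ℝ) / 4 : ℝ) + (-(k * t / 2) : ℝ) * I)‖ + 1) := by
  obtain ⟨c, hc, hΓ⟩ := gammaLowerBound_quarter hk
  set P := ∏ i, (ξ i) ^ (-(1 / 2) : ℝ) with hP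
  have hP0 : 0 ≤ P := Finset.prod_nonneg fun i _ => Real.rpow_nonneg (hξ i).le _
  have hkr : (2 : ℝ) ≤ k := by exact_mod_cast hk
  refine ⟨Real.pi ^ ((k : ℝ) / 4) * Real.exp k * c⁻¹ * (1 + P), by positivity,
    fun j t hjt htj => ?_⟩
  set T : ℝ := 2 ^ j with hT
  have hT1 : 1 ≤ T := one_le_pow₀ (by norm_num)
  have htT : t ≤ 2 * T := by rw [hT, ← pow_succ']; exact htj
  have ht1 : 1 ≤ t := hT1.trans hjt
  refine (norm_epsteinZeta_le hk hξ (rayDirection_re_pos j) (norm_rayDirection j) ht1).trans ?_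
  rw [arg_rayDirection]
  set τ : ℝ := k * t / 2 with hτ
  have hτT : T ≤ τ := by rw [hτ]; nlinarith
  have hτ1 : 1 ≤ τ := hT1.trans hτT
  have hτ0 : 0 < τ := by linarith
  have hT0 : 0 < T := by linarith
  have h1 : ‖Gamma (((k : ℝ) / 4 : ℝ) + τ * I)‖⁻¹ ≤
      c⁻¹ * T ^ (1 / 2 - (k : ℝ) / 4) * Real.exp (Real.pi * τ / 2) := by
    have h2 := inv_anti₀ (by positivity) (hΓ τ hτ1)
    refine h2.trans ?_
    rw [mul_inv, mul_inv, ← Real.rpow_neg hτ0.le, ← Real.exp_neg, neg_neg, neg_sub]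
    -- The exponent is non-positive because `k ≥ 2`, so `τ` may be lowered to `T`.
    have h3 : τ ^ (1 / 2 - (k : ℝ) / 4) ≤ T ^ (1 / 2 - (k : ℝ) / 4) :=
      Real.rpow_le_rpow_of_nonpos hT0 hτT (by linarith)
    gcongr
  -- The exponentials cancel up to `exp (τ / T)`, and `τ = k t / 2 ≤ k T`.
  have h4 : Real.exp (-((Real.pi / 2 - T⁻¹) * τ)) * Real.exp (Real.pi * τ / 2) ≤ Real.exp k := by
    rw [← Real.exp_add]
    refine Real.exp_le_exp.2 ?_
    have : T⁻¹ * τ ≤ k := by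
      rw [inv_mul_le_iff₀ hT0, hτ]; nlinarith
    linarith
  set A := ‖mellin (thetaTail ξ (rayDirection j)) (((k : ℝ) / 4 : ℝ) + τ * I)‖
  set A' := ‖mellin (thetaTail ξ⁻¹ (rayDirection j)⁻¹) (((k : ℝ) / 4 : ℝ) + (-τ : ℝ) * I)‖
  have hA : 0 ≤ A := norm_nonneg _
  have hA' : 0 ≤ A' := norm_nonneg _
  calc _ ≤ Real.pi ^ ((k : ℝ) / 4) * Real.exp (-((Real.pi / 2 - T⁻¹) * τ)) *
        (c⁻¹ * T ^ (1 / 2 - (k : ℝ) / 4) * Real.exp (Real.pi * τ / 2)) *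
        ((1 + P) * (A + A' + 1)) := by gcongr
    _ = Real.pi ^ ((k : ℝ) / 4) * c⁻¹ * T ^ (1 / 2 - (k : ℝ) / 4) *
        (Real.exp (-((Real.pi / 2 - T⁻¹) * τ)) * Real.exp (Real.pi * τ / 2)) *
        ((1 + P) * (A + A' + 1)) := by ring
    _ ≤ Real.pi ^ ((k : ℝ) / 4) * c⁻¹ * T ^ (1 / 2 - (k : ℝ) / 4) * Real.exp k *
        ((1 + P) * (A + A' + 1)) := by gcongr
    _ = _ := by ring

theorem exists_thetaMean_le {k : ℕ} {ξ : Fin k → ℝ} (hξ : ∀ i, 0 < ξ i) (h1 : ThetaMeanBounded ξ)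
    (h2 : ThetaMeanBounded ξ⁻¹) (m : ℕ) :
    ∃ B : ℝ, 1 ≤ B ∧ ∀ j : ℕ,
      thetaMean ξ (rayDirection j) (1 / ((m : ℝ) + 1)) ≤
        ENNReal.ofReal (B * ((2 : ℝ) ^ j) ^ ((k : ℝ) / 2 + 3 * (1 / ((m : ℝ) + 1)))) ∧
      thetaMean ξ⁻¹ (rayDirection j)⁻¹ (1 / ((m : ℝ) + 1)) ≤
        ENNReal.ofReal (B * ((2 : ℝ) ^ j) ^ ((k : ℝ) / 2 + 3 * (1 / ((m : ℝ) + 1)))) := by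
  obtain ⟨B1, hB1⟩ := h1 m
  obtain ⟨B2, hB2⟩ := h2 m
  refine ⟨max 1 (max B1 B2), le_max_left _ _, fun j => ⟨(hB1 j).trans ?_, ?_⟩⟩
  · refine ENNReal.ofReal_le_ofReal (mul_le_mul_of_nonneg_right ?_ (by positivity))
    exact (le_max_left _ _).trans (le_max_right _ _)
  · rw [thetaMean_inv (ξ := ξ⁻¹) (fun i => inv_pos.2 (hξ i)) (rayDirection_re_pos j) (norm_rayDirection j)]
    refine (hB2 j).trans ?_
    refine ENNReal.ofReal_le_ofReal (mul_le_mul_of_nonneg_right ?_ (by positivity))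
    exact (le_max_right _ _).trans (le_max_right _ _)

theorem continuous_norm_epsteinZeta {k : ℕ} (hk : 0 < k) {ξ : Fin k → ℝ} (hξ : ∀ i, 0 < ξ i) :
    Continuous fun t : ℝ => ‖epsteinZeta (Matrix.diagonal ξ) (1 / 2 + t * I)‖ := by
  have h := (isEpsteinContinuation_epsteinZeta hk hξ).1.continuousOn
  refine Continuous.norm (h.comp_continuous (by fun_prop) fun t => ?_)
  intro h
  have := congrArg re h
  norm_num at this

theorem sq_add_add_one_le (a b : ℝ) : (a + b + 1) ^ 2 ≤ 3 * (a ^ 2 + b ^ 2 + 1) := by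
  nlinarith [sq_nonneg (a - b), sq_nonneg (a - 1), sq_nonneg (b - 1)]

/-- Pointwise and mean-square bounds on dyadic intervals. -/
theorem exists_dyadic_bounds {k : ℕ} (hk : 2 ≤ k) {ξ : Fin k → ℝ} (hξ : ∀ i, 0 < ξ i)
    (h1 : ThetaMeanBounded ξ) (h2 : ThetaMeanBounded ξ⁻¹) (m : ℕ) :
    ∃ C : ℝ, 0 < C ∧ ∀ j : ℕ,
      (∀ t : ℝ, (2 : ℝ) ^ j ≤ t → t ≤ 2 ^ (j + 1) →
        ‖epsteinZeta (Matrix.diagonal ξ) (1 / 2 + t * I)‖ ^ 2 ≤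
          C * ((2 : ℝ) ^ j) ^ (1 + 3 * (1 / ((m : ℝ) + 1)))) ∧
      ∫ t in (2 : ℝ) ^ j..2 ^ (j + 1), ‖epsteinZeta (Matrix.diagonal ξ) (1 / 2 + t * I)‖ ^ 2 ≤
          C * ((2 : ℝ) ^ j) ^ (1 + 3 * (1 / ((m : ℝ) + 1))) := by
  obtain ⟨C, hC, hE⟩ := exists_norm_epsteinZeta_le_dyadic hk hξ
  obtain ⟨B, hB, hM⟩ := exists_thetaMean_le hξ h1 h2 m
  set δ : ℝ := 1 / ((m : ℝ) + 1) with hδ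
  have hδ0 : 0 < δ := by positivity
  have hkr : (2 : ℝ) ≤ k := by exact_mod_cast hk
  have hξ' : ∀ i, 0 < ξ⁻¹ i := fun i => inv_pos.2 (hξ i)
  -- The `3` is from `sq_add_add_one_le`, `2B/δ` from the two pointwise bounds, and `1` from the
  -- polar terms; `8πB` covers the `4πB` of the two mean squares.
  refine ⟨3 * C ^ 2 * (2 * B / δ + 8 * Real.pi * B + 1), by positivity, fun j => ?_⟩
  have hω := rayDirection_re_pos j
  have hω' := inv_re_pos hω
  obtain ⟨hM1, hM2⟩ := hM j
  set T : ℝ := 2 ^ j with hT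
  have hT1 : 1 ≤ T := one_le_pow₀ (by norm_num)
  have hT0 : 0 < T := by linarith
  set D : ℝ := B * T ^ ((k : ℝ) / 2 + 3 * δ) with hD
  have hD0 : 0 ≤ D := by positivity
  set A : ℝ → ℂ := fun τ => mellin (thetaTail ξ (rayDirection j)) (((k : ℝ) / 4 : ℝ) + τ * I) with hA
  set A' : ℝ → ℂ := fun τ =>
    mellin (thetaTail ξ⁻¹ (rayDirection j)⁻¹) (((k : ℝ) / 4 : ℝ) + τ * I) with hA'
  have hsq : ∀ t : ℝ, T ≤ t → t ≤ 2 ^ (j + 1) →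
      ‖epsteinZeta (Matrix.diagonal ξ) (1 / 2 + t * I)‖ ^ 2 ≤
        3 * C ^ 2 * T ^ (1 - (k : ℝ) / 2) * (‖A (k * t / 2)‖ ^ 2 + ‖A' (-(k * t / 2))‖ ^ 2 + 1) := by
    intro t ht ht'
    refine (pow_le_pow_left₀ (norm_nonneg _) (hE j t ht ht') 2).trans ?_
    rw [mul_pow, mul_pow, ← Real.rpow_natCast (T ^ _), ← Real.rpow_mul hT0.le,
      show (1 / 2 - (k : ℝ) / 4) * ((2 : ℕ) : ℝ) = 1 - (k : ℝ) / 2 by push_cast; ring]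
    calc _ ≤ C ^ 2 * T ^ (1 - (k : ℝ) / 2) * (3 * (‖A (k * t / 2)‖ ^ 2 + ‖A' (-(k * t / 2))‖ ^ 2 + 1)) := by
          gcongr
          exact sq_add_add_one_le _ _
      _ = _ := by ring
  -- The Gamma factor and the theta mean combine so that `k` disappears from the exponent.
  have hTD : T ^ (1 - (k : ℝ) / 2) * D = B * T ^ (1 + 3 * δ) := by
    rw [hD, mul_left_comm, ← Real.rpow_add hT0]; congr 2; ring
  have hTT : T ^ (1 - (k : ℝ) / 2) * T ≤ T ^ (1 + 3 * δ) := by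
    rw [← Real.rpow_add_one hT0.ne']
    exact Real.rpow_le_rpow_of_exponent_le hT1 (by linarith)
  have hTp : 0 < T ^ (1 - (k : ℝ) / 2) := by positivity
  have hTp' : 0 < T ^ (1 + 3 * δ) := by positivity
  constructor
  · intro t ht ht'
    have key : ∀ x : ℂ, ‖x‖ₑ ^ 2 ≤ ENNReal.ofReal D * ENNReal.ofReal (1 / δ) → ‖x‖ ^ 2 ≤ D / δ := by
      intro x hx
      rw [← ENNReal.ofReal_mul hD0, ← ofReal_norm, ← ENNReal.ofReal_pow (norm_nonneg _),
        ENNReal.ofReal_le_ofReal_iff (by positivity)] at hx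
      rwa [mul_one_div] at hx
    have hA1 := key _ ((enorm_mellin_thetaTail_sq_le hξ hω hδ0 (k * t / 2)).trans
      (mul_le_mul_left hM1 _))
    have hA2 := key _ ((enorm_mellin_thetaTail_sq_le hξ' hω' hδ0 (-(k * t / 2))).trans
      (mul_le_mul_left hM2 _))
    refine (hsq t ht ht').trans ?_
    calc _ ≤ 3 * C ^ 2 * T ^ (1 - (k : ℝ) / 2) * (D / δ + D / δ + T) := by gcongr
      _ = 3 * C ^ 2 * (2 * (T ^ (1 - (k : ℝ) / 2) * D) / δ + T ^ (1 - (k : ℝ) / 2) * T) := by ring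
      _ ≤ 3 * C ^ 2 * (2 * (B * T ^ (1 + 3 * δ)) / δ + T ^ (1 + 3 * δ)) := by rw [hTD]; gcongr
      _ = 3 * C ^ 2 * (2 * B / δ + 1) * T ^ (1 + 3 * δ) := by ring
      _ ≤ _ := by
        gcongr
        have : 0 ≤ 8 * Real.pi * B := by positivity
        linarith
  · have hle : T ≤ 2 ^ (j + 1) := by rw [hT]; exact pow_le_pow_right₀ (by norm_num) (by omega)
    have hcA : Continuous A := (differentiable_mellin_thetaTail hξ hω).continuous.comp (by fun_prop)
    have hcA' : Continuous A' :=
      (differentiable_mellin_thetaTail hξ' hω').continuous.comp (by fun_prop)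
    -- The substitution `τ = ± k t / 2` has Jacobian `2 / k ≤ 1`, and the integral is extended to
    -- the whole line.
    have hint : ∀ (F : ℝ → ℂ) (c : ℝ), Continuous F → c ≠ 0 → |c| = 2 / k →
        ∫⁻ τ : ℝ, ‖F τ‖ₑ ^ 2 ≤ ENNReal.ofReal (2 * Real.pi) * ENNReal.ofReal D →
        ∫ t in T..2 ^ (j + 1), ‖F (t / c)‖ ^ 2 ≤ 2 * Real.pi * D := by
      intro F c hF hc hck hFD
      have hFc : Continuous fun t : ℝ => ‖F (t / c)‖ ^ 2 := by fun_prop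
      rw [intervalIntegral.integral_of_le hle,
        integral_eq_lintegral_of_nonneg_ae (ae_of_all _ fun t => by positivity)
          hFc.aestronglyMeasurable]
      refine ENNReal.toReal_le_of_le_ofReal (by positivity) ?_
      refine (setLIntegral_le_lintegral _ _).trans ?_
      have h3 : ∀ t : ℝ, ENNReal.ofReal (‖F (t / c)‖ ^ 2) = (fun τ => ‖F τ‖ₑ ^ 2) (t / c) := fun t => by
        rw [ENNReal.ofReal_pow (norm_nonneg _), ofReal_norm]
      simp_rw [h3]
      rw [lintegral_comp_div_const (fun τ => ‖F τ‖ₑ ^ 2) hc, hck]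
      refine (mul_le_mul' (ENNReal.ofReal_le_one.2 ?_) hFD).trans (le_of_eq ?_)
      · rw [div_le_one (by linarith)]; exact hkr
      · rw [one_mul, ← ENNReal.ofReal_mul (by positivity)]
    have hI1 := hint A (2 / k) hcA (by positivity) (abs_of_pos (by positivity))
      ((lintegral_mellin_thetaTail_sq_le hξ hω hδ0.le).trans (mul_le_mul_right hM1 _))
    have hI2 := hint A' (-(2 / k)) hcA' (neg_ne_zero.2 (by positivity))
      (by rw [abs_neg, abs_of_pos (by positivity)])
      ((lintegral_mellin_thetaTail_sq_le hξ' hω' hδ0.le).trans (mul_le_mul_right hM2 _))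
    have he1 : ∀ t : ℝ, t / (2 / k) = k * t / 2 := fun t => by field_simp
    have he2 : ∀ t : ℝ, t / (-(2 / k)) = -(k * t / 2) := fun t => by rw [div_neg, he1]
    simp_rw [he1] at hI1
    simp_rw [he2] at hI2
    have hc1 : Continuous fun t : ℝ => ‖A (k * t / 2)‖ ^ 2 := by fun_prop
    have hc2 : Continuous fun t : ℝ => ‖A' (-(k * t / 2))‖ ^ 2 := by fun_prop
    have hc12 : Continuous fun t : ℝ => ‖A (k * t / 2)‖ ^ 2 + ‖A' (-(k * t / 2))‖ ^ 2 := hc1.add hc2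
    have hcE := (continuous_norm_epsteinZeta (by omega) hξ).pow 2
    have hlen : (2 : ℝ) ^ (j + 1) - T = T := by rw [hT, pow_succ]; ring
    calc _ ≤ ∫ t in T..2 ^ (j + 1), 3 * C ^ 2 * T ^ (1 - (k : ℝ) / 2) *
            (‖A (k * t / 2)‖ ^ 2 + ‖A' (-(k * t / 2))‖ ^ 2 + 1) :=
          intervalIntegral.integral_mono_on hle (hcE.intervalIntegrable _ _)
            (((hc12.add continuous_const).const_mul _).intervalIntegrable _ _)
            fun t ht => hsq t ht.1 ht.2
      _ = 3 * C ^ 2 * T ^ (1 - (k : ℝ) / 2) * ((∫ t in T..2 ^ (j + 1), ‖A (k * t / 2)‖ ^ 2) +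
            (∫ t in T..2 ^ (j + 1), ‖A' (-(k * t / 2))‖ ^ 2) + T) := by
          rw [intervalIntegral.integral_const_mul, intervalIntegral.integral_add
            (hc12.intervalIntegrable _ _) (continuous_const.intervalIntegrable _ _),
            intervalIntegral.integral_add (hc1.intervalIntegrable _ _) (hc2.intervalIntegrable _ _),
            intervalIntegral.integral_const, hlen, smul_eq_mul, mul_one]
      _ ≤ 3 * C ^ 2 * T ^ (1 - (k : ℝ) / 2) * (2 * Real.pi * D + 2 * Real.pi * D + T) := by gcongr
      _ = 3 * C ^ 2 * (4 * Real.pi * (T ^ (1 - (k : ℝ) / 2) * D) + T ^ (1 - (k : ℝ) / 2) * T) := by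
          ring
      _ ≤ 3 * C ^ 2 * (4 * Real.pi * (B * T ^ (1 + 3 * δ)) + T ^ (1 + 3 * δ)) := by rw [hTD]; gcongr
      _ = 3 * C ^ 2 * (4 * Real.pi * B + 1) * T ^ (1 + 3 * δ) := by ring
      _ ≤ _ := by
        gcongr
        have : 0 ≤ 2 * B / δ := by positivity
        have : 0 ≤ 4 * Real.pi * B := by positivity
        linarith

/-! ### From dyadic intervals to all heights. -/

/-- Induction on `j` loses nothing, because `a ≥ 1` makes `2 ^ a ≥ 2` absorb the doubling of the
constant. -/
theorem exists_integral_le_of_dyadic {f : ℝ → ℝ} (hf : Continuous f) (hf0 : ∀ t, 0 ≤ f t) {C a : ℝ}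
    (hC : 0 ≤ C) (ha : 1 ≤ a) (h : ∀ j : ℕ, ∫ t in (2 : ℝ) ^ j..2 ^ (j + 1), f t ≤ C * ((2 : ℝ) ^ j) ^ a) :
    ∃ C' : ℝ, 0 ≤ C' ∧ ∀ X : ℝ, 1 ≤ X → ∫ t in (0 : ℝ)..X, f t ≤ C' * X ^ a := by
  set K := C + ∫ t in (0 : ℝ)..1, f t with hK
  have hI0 : 0 ≤ ∫ t in (0 : ℝ)..1, f t :=
    intervalIntegral.integral_nonneg zero_le_one fun t _ => hf0 t
  have hK0 : 0 ≤ K := add_nonneg hC hI0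
  have h2a : (2 : ℝ) ≤ 2 ^ a := by
    simpa using Real.rpow_le_rpow_of_exponent_le (x := 2) (by norm_num) ha
  have hind : ∀ j : ℕ, ∫ t in (0 : ℝ)..2 ^ j, f t ≤ K * ((2 : ℝ) ^ j) ^ a := by
    intro j
    induction j with
    | zero => simp [hK, hC]
    | succ j ih =>
      rw [← intervalIntegral.integral_add_adjacent_intervals (hf.intervalIntegrable 0 (2 ^ j))
        (hf.intervalIntegrable _ _)]
      have h3 : ((2 : ℝ) ^ (j + 1)) ^ a = 2 ^ a * ((2 : ℝ) ^ j) ^ a := by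
        rw [pow_succ', Real.mul_rpow (by norm_num) (by positivity)]
      have h4 : 0 < ((2 : ℝ) ^ j) ^ a := by positivity
      have h5 : C ≤ K := le_add_of_nonneg_right hI0
      calc _ ≤ K * ((2 : ℝ) ^ j) ^ a + C * ((2 : ℝ) ^ j) ^ a := add_le_add ih (h j)
        _ ≤ K * ((2 : ℝ) ^ j) ^ a + K * ((2 : ℝ) ^ j) ^ a := by gcongr
        _ = K * (2 * ((2 : ℝ) ^ j) ^ a) := by ring
        _ ≤ K * (2 ^ a * ((2 : ℝ) ^ j) ^ a) := by gcongr
        _ = _ := by rw [h3]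
  refine ⟨K * 2 ^ a, by positivity, fun X hX => ?_⟩
  obtain ⟨n, hn, hn'⟩ := exists_nat_pow_near hX (one_lt_two (α := ℝ))
  calc ∫ t in (0 : ℝ)..X, f t ≤ ∫ t in (0 : ℝ)..2 ^ (n + 1), f t :=
        intervalIntegral.integral_mono_interval le_rfl (by linarith) hn'.le
          (ae_of_all _ hf0) (hf.intervalIntegrable _ _)
    _ ≤ K * ((2 : ℝ) ^ (n + 1)) ^ a := hind _
    _ ≤ K * (2 * X) ^ a := by
        rw [pow_succ']
        gcongr
    _ = _ := by rw [Real.mul_rpow (by norm_num) (by linarith)]; ring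

theorem exists_norm_epsteinZeta_le {k : ℕ} (hk : 2 ≤ k) {ξ : Fin k → ℝ} (hξ : ∀ i, 0 < ξ i) {C η : ℝ}
    (hC : 0 ≤ C) (hη : 0 ≤ η)
    (h : ∀ (j : ℕ) (t : ℝ), (2 : ℝ) ^ j ≤ t → t ≤ 2 ^ (j + 1) →
      ‖epsteinZeta (Matrix.diagonal ξ) (1 / 2 + t * I)‖ ^ 2 ≤ C * ((2 : ℝ) ^ j) ^ (1 + 2 * η)) :
    ∃ C' : ℝ, 0 ≤ C' ∧ ∀ t : ℝ,
      ‖epsteinZeta (Matrix.diagonal ξ) (1 / 2 + t * I)‖ ≤ C' * (1 + |t|) ^ (1 / 2 + η) := by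
  have hk0 : 0 < k := by omega
  obtain ⟨B, hB⟩ := (isCompact_Icc (a := (0 : ℝ)) (b := 1)).exists_bound_of_continuousOn
    (continuous_norm_epsteinZeta hk0 hξ).continuousOn
  have hB0 : 0 ≤ B := (norm_nonneg _).trans (hB 0 (by simp))
  have hpos : ∀ t : ℝ, 0 ≤ t → ‖epsteinZeta (Matrix.diagonal ξ) (1 / 2 + t * I)‖ ≤
      (B + √C) * (1 + t) ^ (1 / 2 + η) := by
    intro t ht
    have h1 : 1 ≤ (1 + t) ^ (1 / 2 + η) := Real.one_le_rpow (by linarith) (by positivity)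
    rcases le_total t 1 with ht1 | ht1
    · have h2 := hB t ⟨ht, ht1⟩
      rw [norm_norm] at h2
      have : 0 ≤ √C := Real.sqrt_nonneg C
      nlinarith
    · obtain ⟨n, hn, hn'⟩ := exists_nat_pow_near ht1 (one_lt_two (α := ℝ))
      have h2 := h n t hn hn'.le
      have h3 : ‖epsteinZeta (Matrix.diagonal ξ) (1 / 2 + t * I)‖ ≤ √C * (1 + t) ^ (1 / 2 + η) := by
        refine le_of_sq_le_sq (h2.trans ?_) (by positivity)
        rw [mul_pow, Real.sq_sqrt hC, ← Real.rpow_natCast ((1 + t) ^ _), ← Real.rpow_mul (by linarith),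
          show (1 / 2 + η) * ((2 : ℕ) : ℝ) = 1 + 2 * η by push_cast; ring]
        gcongr
        linarith
      nlinarith
  refine ⟨B + √C, by positivity, fun t => ?_⟩
  rcases le_total 0 t with ht | ht
  · rw [abs_of_nonneg ht]; exact hpos t ht
  · have h1 := hpos (-t) (by linarith)
    rw [abs_of_nonpos ht]
    have h2 : (1 / 2 + t * I : ℂ) = (starRingEnd ℂ) (1 / 2 + ((-t : ℝ) : ℂ) * I) := by
      simp [conj_ofNat]
    rw [h2, epsteinZeta_conj hk0 hξ, RCLike.norm_conj]
    · exact h1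
    · intro h
      have := congrArg re h
      norm_num at this

end

/-- Diagonal matrices are identified with the vectors of their diagonal entries, which gives the
topology and the Lebesgue measure on the space of diagonal matrices. -/
theorem proposition3 (k : ℕ) (hk : 2 ≤ k) (D : Set (Fin k → ℝ)) (hD : IsCompact D)
    (hpos : ∀ ξ ∈ D, ∀ i, 0 < ξ i) :
    (∀ ξ ∈ D, IsEpsteinContinuation (Matrix.diagonal ξ) (epsteinZeta (Matrix.diagonal ξ))) ∧
    ∃ M : Set (Fin k → ℝ), M ⊆ D ∧ volume (D \ M) = 0 ∧
      ∀ ξ ∈ M, ∀ ε : ℝ, 0 < ε →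
        (∃ C : ℝ, ∀ X : ℝ, 1 ≤ X →
          ∫ t in (0 : ℝ)..X,
              ‖epsteinZeta (Matrix.diagonal ξ) (1 / 2 + (t : ℂ) * Complex.I)‖ ^ 2
            ≤ C * X ^ (1 + ε)) ∧
        (∃ C : ℝ, ∀ t : ℝ,
          ‖epsteinZeta (Matrix.diagonal ξ) (1 / 2 + (t : ℂ) * Complex.I)‖
            ≤ C * (1 + |t|) ^ (1 / 2 + ε)) := by
  have hk0 : 0 < k := by omega
  refine ⟨fun ξ hξ => isEpsteinContinuation_epsteinZeta hk0 (hpos ξ hξ),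
    {ξ | ξ ∈ D ∧ ThetaMeanBounded ξ ∧ ThetaMeanBounded ξ⁻¹}, fun ξ hξ => hξ.1, ?_, ?_⟩
  -- A point of `D` outside `M` fails the theta bound either for the form or for its dual.
  · refine measure_mono_null ?_ (measure_union_null (ae_thetaMeanBounded k) (ae_thetaMeanBounded_inv k))
    rintro ξ ⟨hξ, hbad⟩
    by_cases h1 : ThetaMeanBounded ξ
    · exact Or.inr ⟨hpos ξ hξ, fun h2 => hbad ⟨hξ, h1, h2⟩⟩
    · exact Or.inl ⟨hpos ξ hξ, h1⟩
  · rintro ξ ⟨hξD, h1, h2⟩ ε hε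
    have hξ := hpos ξ hξD
    -- The dyadic bounds lose `3δ` in the exponent, so `δ < ε / 3` suffices.
    obtain ⟨m, hm⟩ := exists_nat_one_div_lt (show 0 < ε / 3 by positivity)
    obtain ⟨C, hC, h⟩ := exists_dyadic_bounds hk hξ h1 h2 m
    set δ : ℝ := 1 / ((m : ℝ) + 1) with hδ
    have hδ0 : 0 < δ := by positivity
    constructor
    · obtain ⟨K, hK, hint⟩ := exists_integral_le_of_dyadic
        ((continuous_norm_epsteinZeta hk0 hξ).pow 2) (fun t => sq_nonneg _) hC.le
        (a := 1 + 3 * δ) (by linarith) fun j => (h j).2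
      refine ⟨K, fun X hX => (hint X hX).trans ?_⟩
      gcongr
      linarith
    · obtain ⟨K, hK, hsup⟩ := exists_norm_epsteinZeta_le hk hξ hC.le (η := 3 * δ / 2) (by positivity)
        fun j t ht ht' => by
          have := (h j).1 t ht ht'
          rwa [show 1 + 2 * (3 * δ / 2) = 1 + 3 * δ by ring]
      refine ⟨K, fun t => (hsup t).trans ?_⟩
      gcongr
      · linarith [abs_nonneg t]
      · linarith
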